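/- Let $K$ be an algebraically closed field of characteristic zero (for instance $K=\mathbb{C}$), let $V$ be a finite-dimensional $K$-vector space with a symmetric bilinear form $(-,-)$, and let $R\subset V$ be an affine generalized root system (AGRS), that is, a non-empty set such that: (0') $\dim\ker(-,-)=1$, $R\cap\ker(-,-)=\emptyset$ and $R$ spans $V$; (1) if $\alpha,\beta\in R$ and $(\alpha,\alpha)\neq0$, then $\frac{2(\alpha,\beta)}{(\alpha,\alpha)}\in\mathbb{Z}$ and $\beta-\frac{2(\alpha,\beta)}{(\alpha,\alpha)}\alpha\in R$; (2) for every $\alpha\in R$ with $(\alpha,\alpha)=0$ there is a bijection $r_\alpha:R\to R$ with $r_\alpha(\pm\alpha)=\mp\alpha$, $r_\alpha(\beta)=\beta$ if $(\alpha,\beta)=0$ and $\beta\ne\pm\alpha$, and $r_\alpha(\beta)\in\{\beta+\alpha,\beta-\alpha\}$ if $(\alpha,\beta)\neq0$; (3) the image $cl(R)$ of $R$ in $V/\ker(-,-)$ is finite; (4) for every $\alpha\in cl(R)$ there is $\delta_\alpha\in\ker(-,-)$ such that any two elements of $R$ with image $\alpha$ differ by an element of $\mathbb{Z}\delta_\alpha$.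 An isomorphism of two such systems, or of two finite systems, is a bijective linear map between the ambient spaces that maps one set of roots onto the other and multiplies the form by a nonzero scalar. Let $n\ge1$ and suppose that $cl(R)$, in $V/\ker(-,-)$ with the induced form, is isomorphic to $$B(0,n)=\{\pm\delta_i,\ \pm2\delta_i,\ \pm\delta_i\pm\delta_j\}_{1\le i\ne j\le n}\subset K^n,\qquad (\delta_i,\delta_j)=-\delta_{i,j}.$$ Then $R$ is isomorphic to the set of real roots of one of the affine Kac-Moody (super)algebras $B(0,n)^{(1)}$, $C(n+1)^{(2)}$, $A_{2n}^{(2)}$, $A(0,2n-1)^{(2)}$ (the latter only for $n\geq2$) or $A(0,2n)^{(4)}$. Here these sets of real roots lie in the space with basis $\delta_1,\dots,\delta_n,\delta$, where $(\delta_i,\delta_j)=-\delta_{i,j}$ and $\delta$ spans the kernel of the form. The simple roots are $\alpha_0$, $\alpha_i=\delta_i-\delta_{i+1}$ for $1\le i<n$, and $\alpha_n=\delta_n$, with - $B(0,n)^{(1)}$: $\alpha_0=\delta-2\delta_1$, odd simple root $\alpha_n$; - $C(n+1)^{(2)}$: $\alpha_0=\delta-\delta_1$, odd simple roots $\alpha_0,\alpha_n$;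 - $A_{2n}^{(2)}$: $\alpha_0=\delta-2\delta_1$, no odd simple root; - $A(0,2n-1)^{(2)}$, $n\ge2$: $\alpha_0=\delta-\delta_1-\delta_2$, odd simple root $\alpha_n$; - $A(0,2n)^{(4)}$: $\alpha_0=\delta-\delta_1$, odd simple root $\alpha_n$; and the real roots are the images, under the group generated by the reflections in the simple roots, of the simple roots and of the doubles of the odd simple roots. -/

import Mathlib

/-- The reflection `r_α(v) = v - (2(α,v)/(α,α)) α` attached to a vector `α` with `(α,α) ≠ 0`. -/
def rootReflection {K V : Type*} [Field K] [AddCommGroup V] [Module K V]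
    (B : LinearMap.BilinForm K V) (α v : V) : V :=
  v - (2 * B α v / B α α) • α

/-- Affine generalized root systems: `R` is a set of vectors in the finite-dimensional space `V`
with the symmetric bilinear form `B`. The kernel `ker(-,-)` of the form is `LinearMap.ker B`, and
`cl` is the quotient map `(LinearMap.ker B).mkQ` restricted to `R`. -/
structure IsAGRS {K V : Type*} [Field K] [AddCommGroup V] [Module K V]
    (B : LinearMap.BilinForm K V) (R : Set V) : Prop where
  finiteDimensional : FiniteDimensional K V
  symm : B.IsSymm
  nonempty : R.Nonempty
  finrank_ker : Module.finrank K (LinearMap.ker B) = 1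
  notMem_ker : ∀ α ∈ R, α ∉ LinearMap.ker B
  span_eq_top : Submodule.span K R = ⊤
  reflection : ∀ α ∈ R, B α α ≠ 0 → ∀ β ∈ R,
    (∃ m : ℤ, 2 * B α β / B α α = (m : K)) ∧ rootReflection B α β ∈ R
  odd_reflection : ∀ α ∈ R, B α α = 0 → ∃ r : R ≃ R, ∀ β : R,
    ((β : V) = α → (r β : V) = -α) ∧
    ((β : V) = -α → (r β : V) = α) ∧
    (B α β = 0 → (β : V) ≠ α → (β : V) ≠ -α → r β = β) ∧
    (B α β ≠ 0 → (r β : V) = β + α ∨ (r β : V) = β - α)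
  finite_cl : ((LinearMap.ker B).mkQ '' R).Finite
  discrete : ∀ α ∈ (LinearMap.ker B).mkQ '' R, ∃ d ∈ LinearMap.ker B,
    ∀ α' ∈ R, ∀ α'' ∈ R, (LinearMap.ker B).mkQ α' = α → (LinearMap.ker B).mkQ α'' = α →
      ∃ m : ℤ, α'' - α' = m • d

/-- Isomorphism of systems `R ⊆ V` and `R' ⊆ V'`: a bijective linear map which carries `R` onto
`R'` and the form to a nonzero scalar multiple of the form. -/
def SystemIso {K V V' : Type*} [Field K] [AddCommGroup V] [Module K V]
    [AddCommGroup V'] [Module K V']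
    (B : LinearMap.BilinForm K V) (R : Set V) (B' : LinearMap.BilinForm K V') (R' : Set V') :
    Prop :=
  ∃ ψ : V ≃ₗ[K] V', ψ '' R = R' ∧ ∃ a : K, a ≠ 0 ∧ ∀ v w, B' (ψ v) (ψ w) = a * B v w

/-- The form induced by a symmetric form on the quotient by its kernel. -/
def quotForm {K V : Type*} [Field K] [AddCommGroup V] [Module K V]
    (B : LinearMap.BilinForm K V) (hB : B.IsSymm) :
    LinearMap.BilinForm K (V ⧸ LinearMap.ker B) :=
  LinearMap.IsRefl.liftQ₂ B (LinearMap.ker B) hB.isRefl le_rfl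

/-- The form on the space with basis `δ_1, …, δ_n` given by `(δ_i, δ_j) = -1` if `i = j` and
`(δ_i, δ_j) = 0` otherwise. -/
def deltaForm (K : Type*) [Field K] (n : ℕ) : LinearMap.BilinForm K (Fin n → K) :=
  LinearMap.mk₂ K (fun x y => -∑ i, x i * y i)
    (fun x x' y => by simp [add_mul, Finset.sum_add_distrib, add_comm])
    (fun c x y => by simp [mul_assoc, Finset.mul_sum])
    (fun x y y' => by simp [mul_add, Finset.sum_add_distrib, add_comm])
    (fun c x y => by simp [mul_left_comm, Finset.mul_sum])

/-- The finite root system `B(0,n) = BC_n = {±δ_i, ±δ_i ± δ_j, ±2δ_i}` (`i ≠ j`). -/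
def rootsB0 (K : Type*) [Field K] (n : ℕ) : Set (Fin n → K) :=
  {v | ∃ i, ∃ s ∈ ({1, -1} : Set K),
    v = Pi.single i s ∨ v = Pi.single i (2 * s) ∨
      ∃ j, j ≠ i ∧ ∃ t ∈ ({1, -1} : Set K), v = Pi.single i s + Pi.single j t}

/-- The form on the space with basis `δ_1, …, δ_n, δ` that extends `deltaForm` and has `δ` in its
kernel; the element `(x, c)` stands for `∑ i, x_i δ_i + c δ`. -/
def affineForm (K : Type*) [Field K] (n : ℕ) : LinearMap.BilinForm K ((Fin n → K) × K) :=
  (deltaForm K n).compl₁₂ (LinearMap.fst K (Fin n → K) K) (LinearMap.fst K (Fin n → K) K)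

/-- The set of real roots of the symmetrizable Kac-Moody superalgebra with simple roots `a i` (none
of them isotropic for `B`) of which those with index in `odd` are odd: its Cartan matrix is
`2 (a i, a j) / (a i, a i)`. The real roots are the images under the Weyl group, which is generated
by the simple reflections, of the simple roots and of the doubles of the odd simple roots. -/
inductive IsRealRoot {K V ι : Type*} [Field K] [AddCommGroup V] [Module K V]
    (B : LinearMap.BilinForm K V) (a : ι → V) (odd : Set ι) : V → Prop
  | simple (i : ι) : IsRealRoot B a odd (a i)
  | double (i : ι) (hi : i ∈ odd) : IsRealRoot B a odd ((2 : K) • a i)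
  | reflect (i : ι) (v : V) (hv : IsRealRoot B a odd v) :
      IsRealRoot B a odd (rootReflection B (a i) v)

/-- With zero-based indices, `deltaVec K n k` is the basis vector `δ_{k+1}` if `k < n`; it is `0` if
`n ≤ k`. -/
def deltaVec (K : Type*) [Field K] (n k : ℕ) : Fin n → K :=
  fun i => if (i : ℕ) = k then 1 else 0

/-- The simple roots `α_0, α_1, …, α_n` where `α_0 = a₀` is given, `α_i = δ_i - δ_{i+1}` for
`1 ≤ i < n`, and `α_n = δ_n`. -/
def affineSimpleRoots (K : Type*) [Field K] (n : ℕ) (a₀ : (Fin n → K) × K) :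
    Fin (n + 1) → (Fin n → K) × K :=
  Fin.cons a₀ (fun i : Fin n => (deltaVec K n i - deltaVec K n (i + 1), 0))

/-- Real roots of `B(0,n)^{(1)}`: `α_0 = δ - 2δ_1`, and `α_n` is the only odd simple root. -/
def realRootsB0 (K : Type*) [Field K] (n : ℕ) : Set ((Fin n → K) × K) :=
  {v | IsRealRoot (affineForm K n)
    (affineSimpleRoots K n (-((2 : K) • deltaVec K n 0), 1)) {Fin.last n} v}

/-- Real roots of `C(n+1)^{(2)}`: `α_0 = δ - δ_1`, and `α_0`, `α_n` are the odd simple roots. -/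
def realRootsC2 (K : Type*) [Field K] (n : ℕ) : Set ((Fin n → K) × K) :=
  {v | IsRealRoot (affineForm K n)
    (affineSimpleRoots K n (-deltaVec K n 0, 1)) {0, Fin.last n} v}

/-- Real roots of the Lie algebra `A_{2n}^{(2)}`: `α_0 = δ - 2δ_1`, without odd simple roots. -/
def realRootsA2 (K : Type*) [Field K] (n : ℕ) : Set ((Fin n → K) × K) :=
  {v | IsRealRoot (affineForm K n)
    (affineSimpleRoots K n (-((2 : K) • deltaVec K n 0), 1)) ∅ v}

/-- Real roots of `A(0,2n-1)^{(2)}`, for `2 ≤ n`: `α_0 = δ - δ_1 - δ_2`, and `α_n` is the only odd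
simple root. -/
def realRootsA0odd2 (K : Type*) [Field K] (n : ℕ) : Set ((Fin n → K) × K) :=
  {v | IsRealRoot (affineForm K n)
    (affineSimpleRoots K n (-deltaVec K n 0 - deltaVec K n 1, 1)) {Fin.last n} v}

/-- Real roots of `A(0,2n)^{(4)}`: `α_0 = δ - δ_1`, and `α_n` is the only odd simple root. -/
def realRootsA0even4 (K : Type*) [Field K] (n : ℕ) : Set ((Fin n → K) × K) :=
  {v | IsRealRoot (affineForm K n)
    (affineSimpleRoots K n (-deltaVec K n 0, 1)) {Fin.last n} v}

/-!
A system `R` over `B(0,n)` is determined by the multiples of `δ` that may be added to the roots of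
each length. Closure under reflections turns condition (4) into the statement that the roots over
`δ_n` form a string `α + ℤd`, where `d` spans the kernel because `R` spans `V`. Taking `δ = d` and
lifting the simple roots of `B(0,n)` to `R`, starting from `α`, gives coordinates in which `R`
contains all short and medium roots at level `0` and the short roots occur at exactly the integer
levels. Composing two reflections translates levels, so it suffices to know whether `1` is the level
of a medium root and which of `0`, `1`, `2` are levels of long roots. Moving `α` along its string
ensures that a long root at an even level forces one at level `0`. This leaves five possibilities,
and the same translations show that the five sets of real roots realize them.
-/

section Reflections

variable {K V V' : Type*} [Field K] [AddCommGroup V] [Module K V] [AddCommGroup V'] [Module K V']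
  {B : LinearMap.BilinForm K V} {B' : LinearMap.BilinForm K V'}

/-- The coroot `2(α,-)/(α,α)` of a vector `α` with `(α,α) ≠ 0`, as a linear form. Division by zero
makes it `0` when `α` is isotropic. -/
def coroot (B : LinearMap.BilinForm K V) (α : V) : Module.Dual K V :=
  (2 / B α α) • B α

theorem coroot_apply (α v : V) : coroot B α v = 2 * B α v / B α α := div_mul_eq_mul_div _ _ _

theorem coroot_apply_self {α : V} (hα : B α α ≠ 0) : coroot B α α = 2 := by
  rw [coroot_apply, mul_div_cancel_right₀ _ hα]

theorem coroot_smul_left {c : K} (hc : c ≠ 0) (α v : V) :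
    coroot B (c • α) v = coroot B α v / c := by
  simp only [coroot_apply, map_smul, LinearMap.smul_apply, smul_eq_mul]
  field_simp

theorem rootReflection_apply (α v : V) : rootReflection B α v = v - coroot B α v • α := by
  rw [rootReflection, coroot_apply]

theorem rootReflection_eq_preReflection (α : V) :
    rootReflection B α = Module.preReflection α (coroot B α) :=
  funext fun v => (rootReflection_apply α v).trans (Module.preReflection_apply _ _ v).symm

theorem rootReflection_smul_left {c : K} (hc : c ≠ 0) (α v : V) :
    rootReflection B (c • α) v = rootReflection B α v := by
  rw [rootReflection_apply, coroot_smul_left hc, smul_smul, div_mul_cancel₀ _ hc,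
    rootReflection_apply]

theorem rootReflection_neg_left (α v : V) : rootReflection B (-α) v = rootReflection B α v := by
  rw [← neg_one_smul K α, rootReflection_smul_left (neg_ne_zero.2 one_ne_zero)]

theorem rootReflection_self {α : V} (hα : B α α ≠ 0) : rootReflection B α α = -α := by
  rw [rootReflection_eq_preReflection, Module.preReflection_apply_self (coroot_apply_self hα)]

theorem coroot_rootReflection {α : V} (hα : B α α ≠ 0) (v : V) :
    coroot B α (rootReflection B α v) = -coroot B α v := by
  rw [rootReflection_apply, map_sub, map_smul, coroot_apply_self hα, smul_eq_mul]
  ring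

theorem rootReflection_rootReflection (α v : V) :
    rootReflection B α (rootReflection B α v) = v := by
  by_cases hα : B α α = 0
  · simp [rootReflection, hα]
  · rw [rootReflection_eq_preReflection,
      Module.involutive_preReflection (coroot_apply_self hα) v]

theorem apply_rootReflection_rootReflection (hB : B.IsSymm) (α v w : V) :
    B (rootReflection B α v) (rootReflection B α w) = B v w := by
  by_cases hα : B α α = 0
  · simp [rootReflection, hα]
  · simp only [rootReflection, map_sub, map_smul, LinearMap.sub_apply, LinearMap.smul_apply,
      smul_eq_mul, hB.eq v α]
    field_simp
    ring

theorem map_rootReflection (ψ : V →ₗ[K] V') {a : K} (ha : a ≠ 0)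
    (hψ : ∀ v w, B' (ψ v) (ψ w) = a * B v w) (α v : V) :
    ψ (rootReflection B α v) = rootReflection B' (ψ α) (ψ v) := by
  simp only [rootReflection, map_sub, map_smul, hψ]
  rw [mul_left_comm, mul_div_mul_left _ _ ha]

theorem rootReflection_rootReflection_left (hB : B.IsSymm) (α β v : V) :
    rootReflection B (rootReflection B α β) v =
      rootReflection B α (rootReflection B β (rootReflection B α v)) := by
  have hα := rootReflection_eq_preReflection (B := B) α
  have h := map_rootReflection (Module.preReflection α (coroot B α)) one_ne_zero
    (fun v w => by rw [← hα, apply_rootReflection_rootReflection hB, one_mul]) β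
    (rootReflection B α v)
  rw [← hα, rootReflection_rootReflection] at h
  exact h.symm

theorem rootReflection_sub_smul_add (hB : B.IsSymm) {u u' v : V} (hu : B u u = B u' u')
    (h0 : B (u - u') (u - u') ≠ 0) (hv : B (u - u') v = 0) (a : K) :
    rootReflection B (u - u') (a • u + v) = a • u' + v := by
  have h : B (u - u') (u - u') = 2 * B (u - u') u := by
    simp only [map_sub, LinearMap.sub_apply, hB.eq u' u, ← hu]
    ring
  have ha : 2 * B (u - u') (a • u + v) / B (u - u') (u - u') = a := by
    rw [div_eq_iff h0, h, map_add, hv, map_smul, smul_eq_mul]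
    ring
  rw [rootReflection, ha, smul_sub]
  abel

theorem IsRealRoot.rootReflection {ι : Type*} [NeZero (2 : K)] (hB : B.IsSymm) {a : ι → V}
    {odd : Set ι} {α v : V} (hα : IsRealRoot B a odd α) (hv : IsRealRoot B a odd v) :
    IsRealRoot B a odd (rootReflection B α v) := by
  induction hα generalizing v with
  | simple i => exact .reflect i v hv
  | double i _ =>
    rw [rootReflection_smul_left two_ne_zero]
    exact .reflect i v hv
  | reflect i α _ ih =>
    rw [rootReflection_rootReflection_left hB]
    exact .reflect i _ (ih (.reflect i v hv))

end Reflections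

section IntegerVectors

variable {n : ℕ} {z : Fin n → ℤ}

theorem sub_single_dotProduct_self (z : Fin n → ℤ) (i : Fin n) :
    (z - Pi.single i (z i)) ⬝ᵥ (z - Pi.single i (z i)) = z ⬝ᵥ z - z i ^ 2 := by
  simp only [sub_dotProduct, dotProduct_sub, single_dotProduct, dotProduct_single, Pi.sub_apply,
    Pi.single_eq_same]
  ring

theorem exists_apply_ne_zero_of_dotProduct_self (hz : z ⬝ᵥ z ≠ 0) :
    ∃ i, 0 < z i ^ 2 ∧ z i ^ 2 ≤ z ⬝ᵥ z := by
  obtain ⟨i, hi⟩ := Function.ne_iff.1 (mt dotProduct_self_eq_zero.2 hz)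
  have h := sub_single_dotProduct_self z i
  have h0 : 0 ≤ (z - Pi.single i (z i)) ⬝ᵥ (z - Pi.single i (z i)) :=
    Finset.sum_nonneg fun j _ => mul_self_nonneg _
  exact ⟨i, sq_pos_of_ne_zero hi, by linarith⟩

theorem exists_eq_single_of_dotProduct_self_eq_one (hz : z ⬝ᵥ z = 1) :
    ∃ i, ∃ s ∈ ({1, -1} : Set ℤ), z = Pi.single i s := by
  obtain ⟨i, hpos, hle⟩ := exists_apply_ne_zero_of_dotProduct_self (hz.trans_ne one_ne_zero)
  have hi : z i ^ 2 = 1 := by omega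
  have h := sub_single_dotProduct_self z i
  rw [hz, hi, sub_self, dotProduct_self_eq_zero, sub_eq_zero] at h
  exact ⟨i, z i, sq_eq_one_iff.1 hi, h⟩

theorem exists_eq_single_add_single_of_dotProduct_self_eq_two (hz : z ⬝ᵥ z = 2) :
    ∃ i j, j ≠ i ∧ ∃ s ∈ ({1, -1} : Set ℤ), ∃ t ∈ ({1, -1} : Set ℤ),
      z = Pi.single i s + Pi.single j t := by
  obtain ⟨i, hpos, hle⟩ := exists_apply_ne_zero_of_dotProduct_self (hz.trans_ne two_ne_zero)
  have hi : z i = 1 ∨ z i = -1 := by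
    have h1 : z i ≤ 1 := by nlinarith
    have h2 : -1 ≤ z i := by nlinarith
    have h3 : z i ≠ 0 := pow_ne_zero_iff two_ne_zero |>.1 hpos.ne'
    omega
  have h := sub_single_dotProduct_self z i
  rw [hz, sq_eq_one_iff.2 hi] at h
  obtain ⟨j, t, ht, hj⟩ := exists_eq_single_of_dotProduct_self_eq_one h
  refine ⟨i, j, ?_, z i, hi, t, ht, by rw [← hj, add_sub_cancel]⟩
  rintro rfl
  have h0 := congrFun hj j
  rw [Pi.sub_apply, Pi.single_eq_same, Pi.single_eq_same, sub_self] at h0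
  rcases ht with rfl | rfl <;> simp at h0

end IntegerVectors

section FiniteRoots

variable (K : Type*) [Field K] (n : ℕ)

theorem isSymm_deltaForm : (deltaForm K n).IsSymm :=
  ⟨fun x y => congrArg Neg.neg (dotProduct_comm x y)⟩

/-- The lattice spanned by `δ_1, …, δ_n`, that is, the vectors with integral coordinates. Inside it
the short and the medium roots are singled out by their norm. -/
def deltaLattice : AddSubgroup (Fin n → K) :=
  ((Int.castAddHom K).compLeft (Fin n)).range

/-- The short roots `±δ_i` of `B(0,n)`. -/
def shortRoots : Set (Fin n → K) :=
  {x | ∃ i, ∃ s ∈ ({1, -1} : Set K), x = Pi.single i s}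

/-- The roots `±δ_i ± δ_j` of `B(0,n)`, where `i ≠ j`, as sums of two orthogonal short roots. -/
def mediumRoots : Set (Fin n → K) :=
  {x | ∃ u ∈ shortRoots K n, ∃ v ∈ shortRoots K n, deltaForm K n u v = 0 ∧ x = u + v}

/-- The long roots `±2δ_i` of `B(0,n)`, as doubles of the short roots. -/
def longRoots : Set (Fin n → K) :=
  {x | ∃ u ∈ shortRoots K n, x = (2 : K) • u}

variable {K n}

theorem add_mem_mediumRoots {u v : Fin n → K} (hu : u ∈ shortRoots K n) (hv : v ∈ shortRoots K n)
    (huv : deltaForm K n u v = 0) : u + v ∈ mediumRoots K n := ⟨u, hu, v, hv, huv, rfl⟩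

theorem two_smul_mem_longRoots {u : Fin n → K} (hu : u ∈ shortRoots K n) :
    (2 : K) • u ∈ longRoots K n := ⟨u, hu, rfl⟩

theorem deltaForm_apply (x y : Fin n → K) : deltaForm K n x y = -(x ⬝ᵥ y) := rfl

theorem deltaForm_single_single (i j : Fin n) (s t : K) :
    deltaForm K n (Pi.single i s) (Pi.single j t) = if i = j then -(s * t) else 0 := by
  rw [deltaForm_apply, single_dotProduct, Pi.single_apply]
  split_ifs <;> simp

theorem single_mem_shortRoots (i : Fin n) : Pi.single i 1 ∈ shortRoots K n :=
  ⟨i, 1, .inl rfl, rfl⟩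

theorem neg_mem_shortRoots {u : Fin n → K} (hu : u ∈ shortRoots K n) : -u ∈ shortRoots K n := by
  obtain ⟨i, s, hs, rfl⟩ := hu
  refine ⟨i, -s, ?_, (Pi.single_neg (f := fun _ => K) i s).symm⟩
  rcases hs with rfl | rfl <;> simp

theorem deltaForm_self_of_mem_shortRoots {u : Fin n → K} (hu : u ∈ shortRoots K n) :
    deltaForm K n u u = -1 := by
  obtain ⟨i, s, rfl | rfl, rfl⟩ := hu <;> simp [deltaForm_single_single]

theorem deltaForm_eq_zero_or_eq_or_eq_neg {u v : Fin n → K} (hu : u ∈ shortRoots K n)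
    (hv : v ∈ shortRoots K n) : deltaForm K n u v = 0 ∨ v = u ∨ v = -u := by
  obtain ⟨i, s, hs, rfl⟩ := hu
  obtain ⟨j, t, ht, rfl⟩ := hv
  rcases eq_or_ne i j with rfl | hij
  · right
    rcases hs with rfl | rfl <;> rcases ht with rfl | rfl <;> simp [Pi.single_neg]
  · exact .inl (by rw [deltaForm_single_single, if_neg hij])

theorem ne_of_deltaForm_single_single_eq_zero {i j : Fin n} {s t : K} (hs : s ∈ ({1, -1} : Set K))
    (ht : t ∈ ({1, -1} : Set K)) (h : deltaForm K n (Pi.single i s) (Pi.single j t) = 0) :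
    i ≠ j := by
  rintro rfl
  rcases hs with rfl | rfl <;> rcases ht with rfl | rfl <;> simp [deltaForm_single_single] at h

theorem two_le_of_mediumRoots_nonempty (h : (mediumRoots K n).Nonempty) : 2 ≤ n := by
  obtain ⟨_, _, ⟨i, s, hs, rfl⟩, _, ⟨j, t, ht, rfl⟩, hst, rfl⟩ := h
  have := Fin.val_ne_of_ne (ne_of_deltaForm_single_single_eq_zero hs ht hst)
  omega

theorem mem_rootsB0_iff {x : Fin n → K} :
    x ∈ rootsB0 K n ↔ x ∈ shortRoots K n ∨ x ∈ mediumRoots K n ∨ x ∈ longRoots K n := by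
  constructor
  · rintro ⟨i, s, hs, rfl | rfl | ⟨j, hj, t, ht, rfl⟩⟩
    · exact .inl ⟨i, s, hs, rfl⟩
    · exact .inr (.inr ⟨_, ⟨i, s, hs, rfl⟩, by rw [← Pi.single_smul, smul_eq_mul]⟩)
    · exact .inr (.inl ⟨_, ⟨i, s, hs, rfl⟩, _, ⟨j, t, ht, rfl⟩,
        by rw [deltaForm_single_single, if_neg hj.symm], rfl⟩)
  · rintro (⟨i, s, hs, rfl⟩ | ⟨_, ⟨i, s, hs, rfl⟩, _, ⟨j, t, ht, rfl⟩, hst, rfl⟩ |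
      ⟨_, ⟨i, s, hs, rfl⟩, rfl⟩)
    · exact ⟨i, s, hs, .inl rfl⟩
    · exact ⟨i, s, hs, .inr (.inr
        ⟨j, (ne_of_deltaForm_single_single_eq_zero hs ht hst).symm, t, ht, rfl⟩)⟩
    · exact ⟨i, s, hs, .inr (.inl (by rw [← Pi.single_smul, smul_eq_mul]))⟩

theorem compLeft_single (i : Fin n) (k : ℤ) :
    (Int.castAddHom K).compLeft (Fin n) (Pi.single i k) = Pi.single i (k : K) :=
  funext (Pi.apply_single (fun _ => Int.castAddHom K) (fun _ => map_zero _) i k)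

theorem mem_deltaLattice_of_mem_shortRoots {u : Fin n → K} (hu : u ∈ shortRoots K n) :
    u ∈ deltaLattice K n := by
  obtain ⟨i, s, hs, rfl⟩ := hu
  rcases hs with rfl | rfl
  exacts [⟨Pi.single i 1, by simp [compLeft_single]⟩, ⟨Pi.single i (-1), by simp [compLeft_single]⟩]

theorem mem_deltaLattice_of_mem_rootsB0 {x : Fin n → K} (hx : x ∈ rootsB0 K n) :
    x ∈ deltaLattice K n := by
  rw [mem_rootsB0_iff] at hx
  obtain hx | ⟨u, hu, v, hv, -, rfl⟩ | ⟨u, hu, rfl⟩ := hx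
  · exact mem_deltaLattice_of_mem_shortRoots hx
  · exact add_mem (mem_deltaLattice_of_mem_shortRoots hu) (mem_deltaLattice_of_mem_shortRoots hv)
  · rw [two_smul]
    exact add_mem (mem_deltaLattice_of_mem_shortRoots hu) (mem_deltaLattice_of_mem_shortRoots hu)

theorem deltaForm_intCast (z w : Fin n → ℤ) :
    deltaForm K n ((Int.castAddHom K).compLeft (Fin n) z)
      ((Int.castAddHom K).compLeft (Fin n) w) = ((-(z ⬝ᵥ w) : ℤ) : K) := by
  rw [deltaForm_apply, Int.cast_neg]
  exact congrArg Neg.neg ((Int.castRingHom K).map_dotProduct z w).symm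

theorem exists_deltaForm_eq_intCast {x y : Fin n → K} (hx : x ∈ deltaLattice K n)
    (hy : y ∈ deltaLattice K n) : ∃ k : ℤ, deltaForm K n x y = k := by
  obtain ⟨z, rfl⟩ := hx
  obtain ⟨w, rfl⟩ := hy
  exact ⟨_, deltaForm_intCast z w⟩

section CharZero

variable [CharZero K]

theorem mem_shortRoots_iff {x : Fin n → K} :
    x ∈ shortRoots K n ↔ x ∈ deltaLattice K n ∧ deltaForm K n x x = -1 := by
  refine ⟨fun hx => ⟨mem_deltaLattice_of_mem_shortRoots hx, deltaForm_self_of_mem_shortRoots hx⟩,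
    ?_⟩
  rintro ⟨⟨z, rfl⟩, hz⟩
  rw [deltaForm_intCast, ← Int.cast_one, ← Int.cast_neg, Int.cast_inj, neg_inj] at hz
  obtain ⟨i, s, hs, rfl⟩ := exists_eq_single_of_dotProduct_self_eq_one hz
  rw [compLeft_single]
  exact ⟨i, s, by rcases hs with rfl | rfl <;> simp, rfl⟩

theorem mem_mediumRoots_iff {x : Fin n → K} :
    x ∈ mediumRoots K n ↔ x ∈ deltaLattice K n ∧ deltaForm K n x x = -2 := by
  constructor
  · rintro ⟨u, hu, v, hv, huv, rfl⟩
    refine ⟨add_mem (mem_deltaLattice_of_mem_shortRoots hu)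
      (mem_deltaLattice_of_mem_shortRoots hv), ?_⟩
    simp only [map_add, LinearMap.add_apply, deltaForm_self_of_mem_shortRoots, hu, hv, huv,
      (isSymm_deltaForm K n).eq v u]
    norm_num
  · rintro ⟨⟨z, rfl⟩, hz⟩
    rw [deltaForm_intCast, ← Int.cast_two, ← Int.cast_neg, Int.cast_inj, neg_inj] at hz
    obtain ⟨i, j, hij, s, hs, t, ht, rfl⟩ :=
      exists_eq_single_add_single_of_dotProduct_self_eq_two hz
    refine ⟨Pi.single i s, ⟨i, s, ?_, rfl⟩, Pi.single j t, ⟨j, t, ?_, rfl⟩, ?_, ?_⟩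
    · rcases hs with rfl | rfl <;> simp
    · rcases ht with rfl | rfl <;> simp
    · rw [deltaForm_single_single, if_neg hij.symm]
    · rw [map_add, compLeft_single, compLeft_single]

end CharZero

end FiniteRoots

section Layers

variable {K : Type*} [Field K] {n : ℕ}

theorem isSymm_affineForm : (affineForm K n).IsSymm :=
  ⟨fun p q => (isSymm_deltaForm K n).eq p.1 q.1⟩

theorem rootReflection_affineForm (y x : Fin n → K) (d c : K) :
    rootReflection (affineForm K n) (y, d) (x, c) = (rootReflection (deltaForm K n) y x,
      c - coroot (deltaForm K n) y x * d) := by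
  rw [coroot_apply]
  rfl

variable (K n) in
/-- The set of vectors `x + kδ` with `k` an integer where `x` is a short root, or `x` is a medium
root and `k ∈ M`, or `x` is a long root and `k ∈ L`. All affine real root systems over `B(0,n)` have
this shape. -/
def layered (M L : Set ℤ) : Set ((Fin n → K) × K) :=
  {p | ∃ k : ℤ, p.2 = k ∧ (p.1 ∈ shortRoots K n ∨ p.1 ∈ mediumRoots K n ∧ k ∈ M ∨
    p.1 ∈ longRoots K n ∧ k ∈ L)}

variable [CharZero K] {M L : Set ℤ} {y : Fin n → K}

theorem exists_coroot_eq_two_mul_of_mem_shortRoots (hy : y ∈ shortRoots K n) {x : Fin n → K}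
    (hx : x ∈ deltaLattice K n) :
    ∃ k : ℤ, coroot (deltaForm K n) y x = (2 * k : ℤ) := by
  obtain ⟨k, hk⟩ := exists_deltaForm_eq_intCast (mem_deltaLattice_of_mem_shortRoots hy) hx
  refine ⟨-k, ?_⟩
  rw [coroot_apply, hk, deltaForm_self_of_mem_shortRoots hy]
  push_cast
  ring

theorem exists_coroot_eq_intCast (hy : y ∈ rootsB0 K n) {x : Fin n → K}
    (hx : x ∈ deltaLattice K n) :
    ∃ k : ℤ, coroot (deltaForm K n) y x = k := by
  rw [mem_rootsB0_iff] at hy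
  obtain hy | hy | ⟨u, hu, rfl⟩ := hy
  · exact (exists_coroot_eq_two_mul_of_mem_shortRoots hy hx).imp' (2 * ·) fun _ => id
  · obtain ⟨hy, hyy⟩ := mem_mediumRoots_iff.1 hy
    obtain ⟨k, hk⟩ := exists_deltaForm_eq_intCast hy hx
    refine ⟨-k, ?_⟩
    rw [coroot_apply, hk, hyy]
    push_cast
    ring
  · obtain ⟨k, hk⟩ := exists_coroot_eq_two_mul_of_mem_shortRoots hu hx
    refine ⟨k, ?_⟩
    rw [coroot_smul_left two_ne_zero, hk, Int.cast_mul, Int.cast_two,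
      mul_div_cancel_left₀ _ two_ne_zero]

theorem deltaForm_self_ne_zero (hy : y ∈ rootsB0 K n) : deltaForm K n y y ≠ 0 := by
  rw [mem_rootsB0_iff] at hy
  obtain hy | hy | ⟨u, hu, rfl⟩ := hy
  · simp [deltaForm_self_of_mem_shortRoots hy]
  · simp [(mem_mediumRoots_iff.1 hy).2]
  · simp [deltaForm_self_of_mem_shortRoots hu]

theorem rootReflection_mem_layered (hy : y ∈ rootsB0 K n) {w d : ℤ}
    (hw : ∀ x ∈ deltaLattice K n,
      ∃ k : ℤ, coroot (deltaForm K n) y x = (w * k : ℤ))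
    (hM : ∀ l ∈ M, ∀ k, l + w * d * k ∈ M) (hL : ∀ l ∈ L, ∀ k, l + 2 * (w * d) * k ∈ L)
    {p : (Fin n → K) × K} (hp : p ∈ layered K n M L) :
    rootReflection (affineForm K n) (y, (d : K)) p ∈ layered K n M L := by
  have hlattice (x) (hx : x ∈ deltaLattice K n) :
      rootReflection (deltaForm K n) y x ∈ deltaLattice K n := by
    obtain ⟨k, hk⟩ := hw x hx
    rw [rootReflection_apply, hk, Int.cast_smul_eq_zsmul]
    exact sub_mem hx (zsmul_mem (mem_deltaLattice_of_mem_rootsB0 hy) _)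
  have hnorm := fun x => apply_rootReflection_rootReflection (isSymm_deltaForm K n) y x x
  have hshort : ∀ x ∈ shortRoots K n, rootReflection (deltaForm K n) y x ∈ shortRoots K n := by
    simp only [mem_shortRoots_iff, hnorm]
    exact fun x hx => ⟨hlattice x hx.1, hx.2⟩
  obtain ⟨x, _⟩ := p
  obtain ⟨l, rfl, hx | ⟨hx, hl⟩ | ⟨⟨u, hu, rfl⟩, hl⟩⟩ := hp <;> rw [rootReflection_affineForm]
  · obtain ⟨k, hk⟩ := hw x (mem_deltaLattice_of_mem_shortRoots hx)
    exact ⟨l - w * k * d, by rw [hk]; push_cast; ring, .inl (hshort x hx)⟩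
  · rw [mem_mediumRoots_iff] at hx
    obtain ⟨k, hk⟩ := hw x hx.1
    refine ⟨l + w * d * -k, by rw [hk]; push_cast; ring, .inr (.inl ⟨?_, hM l hl _⟩)⟩
    rw [mem_mediumRoots_iff, hnorm]
    exact ⟨hlattice x hx.1, hx.2⟩
  · obtain ⟨k, hk⟩ := hw u (mem_deltaLattice_of_mem_shortRoots hu)
    refine ⟨l + 2 * (w * d) * -k, ?_, .inr (.inr ⟨⟨_, hshort u hu, ?_⟩, hL l hl _⟩)⟩
    · rw [map_smul, smul_eq_mul, hk]
      push_cast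
      ring
    · rw [rootReflection_eq_preReflection, map_smul]

theorem rootReflection_mem_layered_of_mem_rootsB0 (hy : y ∈ rootsB0 K n) {p : (Fin n → K) × K}
    (hp : p ∈ layered K n M L) : rootReflection (affineForm K n) (y, 0) p ∈ layered K n M L := by
  have h := rootReflection_mem_layered (M := M) (L := L) (d := 0) (w := 1) hy
    (by simpa using fun x hx => exists_coroot_eq_intCast hy hx) (by simp) (by simp) hp
  rwa [Int.cast_zero] at h

end Layers

section Coroots

variable {K : Type*} [Field K] {n : ℕ} [CharZero K] {u v : Fin n → K}

theorem coroot_short_self (hu : u ∈ shortRoots K n) : coroot (deltaForm K n) u u = 2 :=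
  coroot_apply_self (deltaForm_self_ne_zero (mem_rootsB0_iff.2 (.inl hu)))

omit [CharZero K] in
theorem coroot_of_orthogonal (huv : deltaForm K n u v = 0) : coroot (deltaForm K n) u v = 0 := by
  rw [coroot_apply, huv, mul_zero, zero_div]

theorem coroot_add_left (hu : u ∈ shortRoots K n) (hv : v ∈ shortRoots K n)
    (huv : deltaForm K n u v = 0) :
    coroot (deltaForm K n) (u + v) u = 1 := by
  simp only [coroot_apply, map_add, LinearMap.add_apply, deltaForm_self_of_mem_shortRoots hu,
    deltaForm_self_of_mem_shortRoots hv, huv, (isSymm_deltaForm K n).eq v u]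
  norm_num

theorem coroot_two_smul_self (hu : u ∈ shortRoots K n) :
    coroot (deltaForm K n) ((2 : K) • u) u = 1 := by
  rw [coroot_smul_left two_ne_zero, coroot_short_self hu, div_self two_ne_zero]

end Coroots

section PointedSystems

variable {K : Type*} [Field K] {n : ℕ}

/-- A pointed system over `B(0,n)`: a set of vectors `x + cδ`, where `x` is a root of `B(0,n)`, that
is closed under the reflections in its elements and contains the short and the medium roots. The
levels `c` are arbitrary elements of `K`, and long roots need not occur. -/
structure IsPointedSystem (X : Set ((Fin n → K) × K)) : Prop where
  fst_mem : ∀ p ∈ X, p.1 ∈ rootsB0 K n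
  rootReflection_mem : ∀ p ∈ X, ∀ q ∈ X, rootReflection (affineForm K n) p q ∈ X
  short_mem : ∀ u ∈ shortRoots K n, (u, 0) ∈ X
  medium_mem : ∀ v ∈ mediumRoots K n, (v, 0) ∈ X

/-- The integers `k` such that `x + kδ ∈ X` for some `x ∈ T`. -/
def levels (X : Set ((Fin n → K) × K)) (T : Set (Fin n → K)) : Set ℤ :=
  {k | ∃ x ∈ T, (x, (k : K)) ∈ X}

theorem mem_levels {X : Set ((Fin n → K) × K)} {T : Set (Fin n → K)} {x : Fin n → K} {k : ℤ}
    (hx : x ∈ T) (h : (x, (k : K)) ∈ X) : k ∈ levels X T := ⟨x, hx, h⟩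

namespace IsPointedSystem

variable {X : Set ((Fin n → K) × K)} {u u' v v' x y : Fin n → K} {a c d : K} {k l : ℤ}

theorem rootReflection_short_mem (hX : IsPointedSystem X) (hu : u ∈ shortRoots K n)
    (hx : (x, c) ∈ X) : (rootReflection (deltaForm K n) u x, c) ∈ X := by
  simpa only [rootReflection_affineForm, mul_zero, sub_zero] using
    hX.rootReflection_mem _ (hX.short_mem u hu) _ hx

variable [CharZero K] (hX : IsPointedSystem X)
include hX

theorem rootReflection_mem_of_mem_rootsB0 (hy : y ∈ rootsB0 K n) (hx : (x, c) ∈ X) :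
    (rootReflection (deltaForm K n) y x, c) ∈ X := by
  rw [mem_rootsB0_iff] at hy
  obtain hy | hy | ⟨u, hu, rfl⟩ := hy
  · exact hX.rootReflection_short_mem hy hx
  · simpa only [rootReflection_affineForm, mul_zero, sub_zero] using
      hX.rootReflection_mem _ (hX.medium_mem y hy) _ hx
  · rw [rootReflection_smul_left two_ne_zero]
    exact hX.rootReflection_short_mem hu hx

theorem smul_short_add_mem (hu : u ∈ shortRoots K n) (hu' : u' ∈ shortRoots K n)
    (huv : deltaForm K n u v = 0) (huv' : deltaForm K n u' v = 0) (h : (a • u + v, c) ∈ X) :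
    (a • u' + v, c) ∈ X := by
  have hsymm := isSymm_deltaForm K n
  obtain h0 | rfl | rfl := deltaForm_eq_zero_or_eq_or_eq_neg hu hu'
  · have hmedium : u - u' ∈ mediumRoots K n :=
      ⟨u, hu, -u', neg_mem_shortRoots hu', by rw [map_neg, h0, neg_zero], sub_eq_add_neg u u'⟩
    rw [← rootReflection_sub_smul_add hsymm (B := deltaForm K n) (u := u)]
    · exact hX.rootReflection_mem_of_mem_rootsB0 (mem_rootsB0_iff.2 (.inr (.inl hmedium))) h
    · rw [deltaForm_self_of_mem_shortRoots hu, deltaForm_self_of_mem_shortRoots hu']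
    · exact deltaForm_self_ne_zero (mem_rootsB0_iff.2 (.inr (.inl hmedium)))
    · rw [map_sub, LinearMap.sub_apply, huv, huv', sub_zero]
  · exact h
  · have hrefl : rootReflection (deltaForm K n) u (a • u + v) = a • -u + v := by
      rw [rootReflection_eq_preReflection, map_add, map_smul, ← rootReflection_eq_preReflection,
        rootReflection_self (by simp [deltaForm_self_of_mem_shortRoots hu])]
      simp [rootReflection, huv]
    exact hrefl ▸ hX.rootReflection_short_mem hu h

theorem mem_of_mem_shortRoots (hu : u ∈ shortRoots K n) (hu' : u' ∈ shortRoots K n)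
    (h : (u, c) ∈ X) : (u', c) ∈ X := by
  simpa using hX.smul_short_add_mem (a := 1) (v := 0) hu hu' (map_zero _) (map_zero _)
    (by simpa using h)

theorem two_smul_short_mem (hu : u ∈ shortRoots K n) (hu' : u' ∈ shortRoots K n)
    (h : ((2 : K) • u, c) ∈ X) : ((2 : K) • u', c) ∈ X := by
  simpa using hX.smul_short_add_mem (a := 2) (v := 0) hu hu' (map_zero _) (map_zero _)
    (by simpa using h)

theorem orthogonal_add_mem (hu : u ∈ shortRoots K n) (hv : v ∈ shortRoots K n)
    (huv : deltaForm K n u v = 0) (hu' : u' ∈ shortRoots K n) (hv' : v' ∈ shortRoots K n)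
    (huv' : deltaForm K n u' v' = 0) (h : (u + v, c) ∈ X) : (u' + v', c) ∈ X := by
  have replace {w w' z : Fin n → K} (hw : w ∈ shortRoots K n) (hw' : w' ∈ shortRoots K n)
      (hwz : deltaForm K n w z = 0) (hwz' : deltaForm K n w' z = 0) (h : (w + z, c) ∈ X) :
      (w' + z, c) ∈ X := by
    simpa using hX.smul_short_add_mem (a := 1) hw hw' hwz hwz' (by simpa using h)
  have hsymm := (isSymm_deltaForm K n).eq
  by_cases huv'' : deltaForm K n u' v = 0
  · rw [add_comm]
    refine replace hv hv' (by rw [hsymm, huv'']) (by rw [hsymm, huv']) ?_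
    rw [add_comm]
    exact replace hu hu' huv huv'' h
  · have huu' : deltaForm K n u u' = 0 := by
      obtain h0 | rfl | rfl := deltaForm_eq_zero_or_eq_or_eq_neg hu' hv
      · exact absurd h0 huv''
      · exact huv
      · simpa using huv
    rw [add_comm]
    refine replace hu hv' huu' (by rw [hsymm, huv']) ?_
    rw [add_comm]
    refine replace hv hu' (by rw [hsymm, huv]) (by rw [hsymm, huu']) ?_
    rwa [add_comm]

theorem add_zsmul_mem (hy : (y, d) ∈ X) (hx : (x, c) ∈ X) {t : K}
    (ht : coroot (deltaForm K n) y x = t) (k : ℤ) : (x, c + k * (t * d)) ∈ X := by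
  have hyB := hX.fst_mem _ hy
  have hpos {c : K} (hx : (x, c) ∈ X) : (x, c + t * d) ∈ X := by
    have h := hX.rootReflection_mem _ hy _ (hX.rootReflection_mem_of_mem_rootsB0 hyB hx)
    rwa [rootReflection_affineForm, rootReflection_rootReflection,
      coroot_rootReflection (deltaForm_self_ne_zero hyB), ht, neg_mul, sub_neg_eq_add] at h
  have hneg {c : K} (hx : (x, c) ∈ X) : (x, c - t * d) ∈ X := by
    have h := hX.rootReflection_mem _ hy _ hx
    rw [rootReflection_affineForm] at h
    have h := hX.rootReflection_mem_of_mem_rootsB0 hyB h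
    rwa [rootReflection_rootReflection, ht] at h
  induction k with
  | zero => simpa using hx
  | succ k ih =>
    convert hpos ih using 2
    push_cast
    ring
  | pred k ih =>
    convert hneg ih using 2
    push_cast
    ring

theorem exists_short_mem {p : (Fin n → K) × K} (hp : p ∈ X) :
    ∃ u ∈ shortRoots K n, (u, p.2) ∈ X := by
  have h := hX.fst_mem p hp
  rw [mem_rootsB0_iff] at h
  obtain ⟨x, c⟩ := p
  obtain hu | ⟨u, hu, v, hv, huv, rfl⟩ | ⟨u, hu, rfl⟩ := h
  · exact ⟨x, hu, hp⟩
  · have h1 := hX.add_zsmul_mem hp (hX.short_mem u hu)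
      (by rw [coroot_add_left hu hv huv]) 1
    exact ⟨u, hu, by simpa using h1⟩
  · have h1 := hX.add_zsmul_mem hp (hX.short_mem u hu)
      (by rw [coroot_two_smul_self hu]) 1
    exact ⟨u, hu, by simpa using h1⟩

theorem add_mem_levels {T : Set (Fin n → K)} (hx : x ∈ T) {t d : ℤ} (hyX : (y, (d : K)) ∈ X)
    (hxX : (x, (l : K)) ∈ X) (ht : coroot (deltaForm K n) y x = t) (k : ℤ) :
    l + k * (t * d) ∈ levels X T :=
  mem_levels hx (by exact_mod_cast hX.add_zsmul_mem hyX hxX ht k)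

theorem short_add_short_mem_levels (hk : k ∈ levels X (shortRoots K n))
    (hl : l ∈ levels X (shortRoots K n)) (j : ℤ) : l + j * (2 * k) ∈ levels X (shortRoots K n) := by
  obtain ⟨u, hu, hk⟩ := hk
  obtain ⟨v, hv, hl⟩ := hl
  refine hX.add_mem_levels hu hk (hX.mem_of_mem_shortRoots hv hu hl) ?_ j
  rw [coroot_short_self hu, Int.cast_two]

theorem medium_add_short_mem_levels (hk : k ∈ levels X (shortRoots K n))
    (hl : l ∈ levels X (mediumRoots K n)) (j : ℤ) :
    l + j * (2 * k) ∈ levels X (mediumRoots K n) := by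
  obtain ⟨w, hw, hk⟩ := hk
  obtain ⟨x, ⟨u, hu, v, hv, huv, rfl⟩, hl⟩ := hl
  have huX := hX.mem_of_mem_shortRoots hw hu hk
  refine hX.add_mem_levels (add_mem_mediumRoots hu hv huv) huX hl ?_ j
  rw [map_add, coroot_short_self hu, coroot_of_orthogonal huv, add_zero, Int.cast_two]

theorem long_add_short_mem_levels (hk : k ∈ levels X (shortRoots K n))
    (hl : l ∈ levels X (longRoots K n)) (j : ℤ) : l + j * (4 * k) ∈ levels X (longRoots K n) := by
  obtain ⟨w, hw, hk⟩ := hk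
  obtain ⟨x, ⟨u, hu, rfl⟩, hl⟩ := hl
  refine hX.add_mem_levels (two_smul_mem_longRoots hu) (hX.mem_of_mem_shortRoots hw hu hk) hl ?_ j
  rw [map_smul, coroot_short_self hu]
  norm_num

theorem short_add_medium_mem_levels (hk : k ∈ levels X (mediumRoots K n))
    (hl : l ∈ levels X (shortRoots K n)) (j : ℤ) : l + j * k ∈ levels X (shortRoots K n) := by
  obtain ⟨x, ⟨u, hu, v, hv, huv, rfl⟩, hk⟩ := hk
  obtain ⟨w, hw, hl⟩ := hl
  rw [← one_mul k]
  refine hX.add_mem_levels hu hk (hX.mem_of_mem_shortRoots hw hu hl) ?_ j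
  rw [coroot_add_left hu hv huv, Int.cast_one]

theorem medium_add_medium_mem_levels (hk : k ∈ levels X (mediumRoots K n))
    (hl : l ∈ levels X (mediumRoots K n)) (j : ℤ) :
    l + j * (2 * k) ∈ levels X (mediumRoots K n) := by
  obtain ⟨x, ⟨u, hu, v, hv, huv, rfl⟩, hk⟩ := hk
  obtain ⟨x, ⟨u', hu', v', hv', huv', rfl⟩, hl⟩ := hl
  have hmedium := add_mem_mediumRoots hu hv huv
  refine hX.add_mem_levels hmedium hk (hX.orthogonal_add_mem hu' hv' huv' hu hv huv hl) ?_ j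
  rw [coroot_apply_self (deltaForm_self_ne_zero (mem_rootsB0_iff.2 (.inr (.inl hmedium)))),
    Int.cast_two]

theorem long_add_medium_mem_levels (hk : k ∈ levels X (mediumRoots K n))
    (hl : l ∈ levels X (longRoots K n)) (j : ℤ) : l + j * (2 * k) ∈ levels X (longRoots K n) := by
  obtain ⟨x, ⟨u, hu, v, hv, huv, rfl⟩, hk⟩ := hk
  obtain ⟨x, ⟨w, hw, rfl⟩, hl⟩ := hl
  refine hX.add_mem_levels (two_smul_mem_longRoots hu) hk (hX.two_smul_short_mem hw hu hl) ?_ j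
  rw [map_smul, coroot_add_left hu hv huv, smul_eq_mul, mul_one, Int.cast_two]

theorem short_add_long_mem_levels (hk : k ∈ levels X (longRoots K n))
    (hl : l ∈ levels X (shortRoots K n)) (j : ℤ) : l + j * k ∈ levels X (shortRoots K n) := by
  obtain ⟨x, ⟨u, hu, rfl⟩, hk⟩ := hk
  obtain ⟨w, hw, hl⟩ := hl
  rw [← one_mul k]
  refine hX.add_mem_levels hu hk (hX.mem_of_mem_shortRoots hw hu hl) ?_ j
  rw [coroot_two_smul_self hu, Int.cast_one]

theorem medium_add_long_mem_levels (hk : k ∈ levels X (longRoots K n))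
    (hl : l ∈ levels X (mediumRoots K n)) (j : ℤ) : l + j * k ∈ levels X (mediumRoots K n) := by
  obtain ⟨x, ⟨w, hw, rfl⟩, hk⟩ := hk
  obtain ⟨x, ⟨u, hu, v, hv, huv, rfl⟩, hl⟩ := hl
  rw [← one_mul k]
  refine hX.add_mem_levels (add_mem_mediumRoots hu hv huv) (hX.two_smul_short_mem hw hu hk) hl ?_ j
  rw [map_add, coroot_two_smul_self hu, coroot_smul_left two_ne_zero, coroot_of_orthogonal huv,
    zero_div, add_zero, Int.cast_one]

theorem long_add_long_mem_levels (hk : k ∈ levels X (longRoots K n))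
    (hl : l ∈ levels X (longRoots K n)) (j : ℤ) : l + j * (2 * k) ∈ levels X (longRoots K n) := by
  obtain ⟨x, ⟨u, hu, rfl⟩, hk⟩ := hk
  obtain ⟨x, ⟨w, hw, rfl⟩, hl⟩ := hl
  refine hX.add_mem_levels (two_smul_mem_longRoots hu) hk (hX.two_smul_short_mem hw hu hl) ?_ j
  rw [map_smul, coroot_two_smul_self hu, smul_eq_mul, mul_one, Int.cast_two]

theorem layered_subset {M L : Set ℤ} (hS : ∀ k, k ∈ levels X (shortRoots K n))
    (hM : (mediumRoots K n).Nonempty → M ⊆ levels X (mediumRoots K n))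
    (hL : L ⊆ levels X (longRoots K n)) : layered K n M L ⊆ X := by
  rintro ⟨x, c⟩ ⟨k, rfl, hx | ⟨hx, hk⟩ | ⟨hx, hk⟩⟩
  · obtain ⟨u, hu, huX⟩ := hS k
    exact hX.mem_of_mem_shortRoots hu hx huX
  · obtain ⟨_, ⟨u, hu, v, hv, huv, rfl⟩, huX⟩ := hM ⟨x, hx⟩ hk
    obtain ⟨u', hu', v', hv', huv', rfl⟩ := hx
    exact hX.orthogonal_add_mem hu hv huv hu' hv' huv' huX
  · obtain ⟨_, ⟨u, hu, rfl⟩, huX⟩ := hL hk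
    obtain ⟨u', hu', rfl⟩ := hx
    exact hX.two_smul_short_mem hu hu' huX

theorem subset_layered {M L : Set ℤ}
    (hint : ∀ u ∈ shortRoots K n, ∀ c, (u, c) ∈ X → ∃ k : ℤ, c = k)
    (hM : levels X (mediumRoots K n) ⊆ M) (hL : levels X (longRoots K n) ⊆ L) :
    X ⊆ layered K n M L := by
  intro p hp
  obtain ⟨u, hu, huX⟩ := hX.exists_short_mem hp
  obtain ⟨k, hk⟩ := hint u hu _ huX
  obtain ⟨x, _⟩ := p
  obtain rfl := hk
  obtain hx | hx | hx := mem_rootsB0_iff.1 (hX.fst_mem _ hp)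
  · exact ⟨k, rfl, .inl hx⟩
  · exact ⟨k, rfl, .inr (.inl ⟨hx, hM (mem_levels hx hp)⟩)⟩
  · exact ⟨k, rfl, .inr (.inr ⟨hx, hL (mem_levels hx hp)⟩)⟩

end IsPointedSystem

end PointedSystems

section SimpleRoots

variable {K : Type*} [Field K] [CharZero K]

theorem add_mem_of_forall_rootReflection_mem {n : ℕ} {Y : Set (Fin n → K)}
    (hY : ∀ y ∈ Y, ∀ x ∈ Y, rootReflection (deltaForm K n) y x ∈ Y) {i j : Fin n} (hij : i ≠ j)
    (h : Pi.single i 1 - Pi.single j 1 ∈ Y) {v : Fin n → K}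
    (hi : deltaForm K n (Pi.single i 1) v = 0) (hj : deltaForm K n (Pi.single j 1) v = 0)
    (hv : Pi.single j 1 + v ∈ Y) : Pi.single i 1 + v ∈ Y := by
  have hrefl := rootReflection_sub_smul_add (isSymm_deltaForm K n) (u := Pi.single j 1)
    (u' := Pi.single i 1) (v := v) (by simp [deltaForm_single_single])
    (by simp [deltaForm_single_single, hij, hij.symm]; norm_num) (by simp [hi, hj]) 1
  rw [one_smul, one_smul, ← neg_sub, rootReflection_neg_left] at hrefl
  exact hrefl ▸ hY _ h _ hv

variable {m : ℕ}

section ReflectionClosed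

variable {Y : Set (Fin (m + 1) → K)}
  (hY : ∀ y ∈ Y, ∀ x ∈ Y, rootReflection (deltaForm K (m + 1)) y x ∈ Y)
  (hsub : ∀ i : Fin m, Pi.single i.castSucc 1 - Pi.single i.succ 1 ∈ Y)
include hY hsub

theorem shortRoots_subset_of_forall_rootReflection_mem (hlast : Pi.single (Fin.last m) 1 ∈ Y) :
    shortRoots K (m + 1) ⊆ Y := by
  have hsingle (i : Fin (m + 1)) : Pi.single i 1 ∈ Y := by
    induction i using Fin.reverseInduction with
    | last => exact hlast
    | cast i ih =>
      simpa using add_mem_of_forall_rootReflection_mem hY i.castSucc_lt_succ.ne (hsub i)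
        (v := 0) (map_zero _) (map_zero _) (by simpa using ih)
  rintro _ ⟨i, s, rfl | rfl, rfl⟩
  · exact hsingle i
  · have h := hY _ (hsingle i) _ (hsingle i)
    rwa [rootReflection_self (by simp [deltaForm_single_single]), ← Pi.single_neg] at h

theorem single_sub_single_mem_of_forall_rootReflection_mem {i j : Fin (m + 1)} (hij : i < j) :
    Pi.single i 1 - Pi.single j 1 ∈ Y := by
  induction j using Fin.induction with
  | zero => exact absurd hij (Fin.not_lt_zero i)
  | succ j ih =>
    obtain h | rfl := (Fin.le_castSucc_iff.2 hij).lt_or_eq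
    · rw [sub_eq_add_neg]
      refine add_mem_of_forall_rootReflection_mem hY h.ne (ih h) ?_ ?_
        (by simpa only [sub_eq_add_neg] using hsub j)
      · simp [deltaForm_single_single, hij.ne]
      · simp [deltaForm_single_single, j.castSucc_lt_succ.ne]
    · exact hsub j

theorem mediumRoots_subset_of_forall_rootReflection_mem (hlast : Pi.single (Fin.last m) 1 ∈ Y) :
    mediumRoots K (m + 1) ⊆ Y := by
  have hshort := shortRoots_subset_of_forall_rootReflection_mem hY hsub hlast
  have hneg {u v : Fin (m + 1) → K} (hu : u ∈ shortRoots K (m + 1))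
      (huv : deltaForm K (m + 1) u v = 0) (h : u + v ∈ Y) : -u + v ∈ Y := by
    have hrefl : rootReflection (deltaForm K (m + 1)) u (u + v) = -u + v := by
      rw [rootReflection_apply, map_add, coroot_short_self hu, coroot_of_orthogonal huv]
      module
    exact hrefl ▸ hY u (hshort hu) _ h
  have hlt {i j : Fin (m + 1)} (hij : i < j) {s t : K} (hs : s ∈ ({1, -1} : Set K))
      (ht : t ∈ ({1, -1} : Set K)) : Pi.single i s + Pi.single j t ∈ Y := by
    have h : Pi.single i 1 + -Pi.single j 1 ∈ Y := by
      rw [← sub_eq_add_neg]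
      exact single_sub_single_mem_of_forall_rootReflection_mem hY hsub hij
    have hi (x : K) : Pi.single i 1 + Pi.single j x ∈ Y → Pi.single i s + Pi.single j x ∈ Y := by
      obtain rfl | rfl := hs
      · exact id
      · rw [Pi.single_neg]
        exact hneg (single_mem_shortRoots i) (by simp [deltaForm_single_single, hij.ne])
    apply hi
    obtain rfl | rfl := ht
    · rw [add_comm (Pi.single i _)] at h ⊢
      simpa using hneg (neg_mem_shortRoots (single_mem_shortRoots j))
        (by simp [deltaForm_single_single, hij.ne']) h
    · rwa [Pi.single_neg]
  rintro _ ⟨_, ⟨i, s, hs, rfl⟩, _, ⟨j, t, ht, rfl⟩, hij, rfl⟩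
  obtain h | h := (ne_of_deltaForm_single_single_eq_zero hs ht hij).lt_or_gt
  · exact hlt h hs ht
  · rw [add_comm (Pi.single i _)]
    exact hlt h ht hs

end ReflectionClosed

theorem isPointedSystem_of_simple {X : Set ((Fin (m + 1) → K) × K)}
    (hfst : ∀ p ∈ X, p.1 ∈ rootsB0 K (m + 1))
    (hX : ∀ p ∈ X, ∀ q ∈ X, rootReflection (affineForm K (m + 1)) p q ∈ X)
    (hsub : ∀ i : Fin m, (Pi.single i.castSucc 1 - Pi.single i.succ 1, 0) ∈ X)
    (hlast : (Pi.single (Fin.last m) 1, 0) ∈ X) : IsPointedSystem X := by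
  have hY (y) (hy : y ∈ {y | (y, 0) ∈ X}) (x) (hx : x ∈ {x | (x, 0) ∈ X}) :
      rootReflection (deltaForm K (m + 1)) y x ∈ {x | (x, 0) ∈ X} := by
    have h := hX _ hy _ hx
    rwa [rootReflection_affineForm, mul_zero, sub_zero] at h
  exact ⟨hfst, hX, shortRoots_subset_of_forall_rootReflection_mem hY hsub hlast,
    mediumRoots_subset_of_forall_rootReflection_mem hY hsub hlast⟩

end SimpleRoots

section Classification

namespace IsPointedSystem

variable {K : Type*} [Field K] [CharZero K] {n : ℕ} {X : Set ((Fin n → K) × K)}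
  (hX : IsPointedSystem X)
include hX

omit [CharZero K] in
theorem zero_mem_levels_short [NeZero n] : 0 ∈ levels X (shortRoots K n) :=
  mem_levels (single_mem_shortRoots 0) (by
    rw [Int.cast_zero]
    exact hX.short_mem _ (single_mem_shortRoots 0))

omit [CharZero K] in
theorem zero_mem_levels_medium (h : (mediumRoots K n).Nonempty) : 0 ∈ levels X (mediumRoots K n) :=
  h.elim fun v hv => mem_levels hv (by
    rw [Int.cast_zero]
    exact hX.medium_mem v hv)

theorem mem_levels_short_of_one_mem_short [NeZero n] (h1 : 1 ∈ levels X (shortRoots K n)) (k : ℤ) :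
    k ∈ levels X (shortRoots K n) := by
  obtain ⟨j, rfl | rfl⟩ := k.even_or_odd'
  · convert hX.short_add_short_mem_levels h1 hX.zero_mem_levels_short j using 1
    ring
  · convert hX.short_add_short_mem_levels h1 h1 j using 1
    ring

theorem even_subset_levels_medium (h1 : 1 ∈ levels X (shortRoots K n))
    (h : (mediumRoots K n).Nonempty) : {k | Even k} ⊆ levels X (mediumRoots K n) := by
  rintro _ ⟨j, rfl⟩
  convert hX.medium_add_short_mem_levels h1 (hX.zero_mem_levels_medium h) j using 1
  ring

theorem mem_levels_short_of_one_mem_long [NeZero n] (h1 : 1 ∈ levels X (longRoots K n)) (k : ℤ) :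
    k ∈ levels X (shortRoots K n) := by
  simpa using hX.short_add_long_mem_levels h1 hX.zero_mem_levels_short k

theorem mem_levels_medium_of_one_mem_long (h1 : 1 ∈ levels X (longRoots K n))
    (h : (mediumRoots K n).Nonempty) (k : ℤ) : k ∈ levels X (mediumRoots K n) := by
  simpa using hX.medium_add_long_mem_levels h1 (hX.zero_mem_levels_medium h) k

theorem odd_subset_levels_long (h1 : 1 ∈ levels X (longRoots K n)) :
    {k | Odd k} ⊆ levels X (longRoots K n) := by
  rintro _ ⟨j, rfl⟩
  convert hX.long_add_long_mem_levels h1 h1 j using 1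
  ring

theorem layered_univ_odd_subset [NeZero n] (h1 : 1 ∈ levels X (longRoots K n)) :
    layered K n .univ {k | Odd k} ⊆ X :=
  hX.layered_subset (hX.mem_levels_short_of_one_mem_long h1)
    (fun h k _ => hX.mem_levels_medium_of_one_mem_long h1 h k) (hX.odd_subset_levels_long h1)

theorem layered_univ_univ_subset [NeZero n] (h0 : 0 ∈ levels X (longRoots K n))
    (h1 : 1 ∈ levels X (longRoots K n)) : layered K n .univ .univ ⊆ X := by
  refine hX.layered_subset (hX.mem_levels_short_of_one_mem_long h1)
    (fun h k _ => hX.mem_levels_medium_of_one_mem_long h1 h k) fun k _ => ?_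
  obtain ⟨j, rfl⟩ | hk := k.even_or_odd
  · convert hX.long_add_long_mem_levels h1 h0 j using 1
    ring
  · exact hX.odd_subset_levels_long h1 hk

theorem layered_univ_even_subset [NeZero n] (h0 : 0 ∈ levels X (longRoots K n))
    (h1 : 1 ∈ levels X (mediumRoots K n)) : layered K n .univ {k | Even k} ⊆ X := by
  have hS (k : ℤ) : k ∈ levels X (shortRoots K n) := by
    simpa using hX.short_add_medium_mem_levels h1 hX.zero_mem_levels_short k
  refine hX.layered_subset hS (fun h k _ => ?_) ?_
  · obtain hk | ⟨j, rfl⟩ := k.even_or_odd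
    · exact hX.even_subset_levels_medium (hS 1) h hk
    · convert hX.medium_add_medium_mem_levels h1 h1 j using 1
      ring
  · rintro _ ⟨j, rfl⟩
    convert hX.long_add_medium_mem_levels h1 h0 j using 1
    ring

theorem layered_even_four_dvd_subset [NeZero n] (h0 : 0 ∈ levels X (longRoots K n))
    (h1 : 1 ∈ levels X (shortRoots K n)) : layered K n {k | Even k} {k | 4 ∣ k} ⊆ X := by
  refine hX.layered_subset (hX.mem_levels_short_of_one_mem_short h1)
    (hX.even_subset_levels_medium h1) ?_
  rintro _ ⟨j, rfl⟩
  convert hX.long_add_short_mem_levels h1 h0 j using 1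
  ring

theorem layered_even_even_subset [NeZero n] (h0 : 0 ∈ levels X (longRoots K n))
    (h2 : 2 ∈ levels X (longRoots K n)) (h1 : 1 ∈ levels X (shortRoots K n)) :
    layered K n {k | Even k} {k | Even k} ⊆ X := by
  refine hX.layered_subset (hX.mem_levels_short_of_one_mem_short h1)
    (hX.even_subset_levels_medium h1) ?_
  rintro k ⟨j, rfl⟩
  obtain ⟨i, rfl | rfl⟩ := j.even_or_odd'
  · convert hX.long_add_short_mem_levels h1 h0 i using 1
    ring
  · convert hX.long_add_short_mem_levels h1 h2 i using 1
    ring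

theorem levels_long_subset_even (h1 : 1 ∈ levels X (shortRoots K n))
    (hL : 1 ∉ levels X (longRoots K n)) : levels X (longRoots K n) ⊆ {k | Even k} := by
  intro l hl
  by_contra hodd
  obtain ⟨j, hj⟩ | ⟨j, hj⟩ : (∃ j, l = 4 * j + 1) ∨ ∃ j, l = 4 * j - 1 := by
    have hodd : l % 2 = 1 := Int.not_even_iff.1 hodd
    obtain h | h : l % 4 = 1 ∨ l % 4 = 3 := by omega
    exacts [.inl ⟨l / 4, by omega⟩, .inr ⟨l / 4 + 1, by omega⟩]
  · apply hL
    convert hX.long_add_short_mem_levels h1 hl (-j) using 1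
    linarith
  · apply hL
    convert hX.long_add_short_mem_levels h1 (hX.long_add_long_mem_levels hl hl (-1)) j using 1
    linarith

theorem levels_medium_subset_even (h1 : 1 ∈ levels X (shortRoots K n))
    (hM : 1 ∉ levels X (mediumRoots K n)) : levels X (mediumRoots K n) ⊆ {k | Even k} := by
  intro l hl
  by_contra hodd
  obtain ⟨j, rfl⟩ := Int.not_even_iff_odd.1 hodd
  apply hM
  convert hX.medium_add_short_mem_levels h1 hl (-j) using 1
  ring

theorem levels_long_subset_four_dvd (h1 : 1 ∈ levels X (shortRoots K n))
    (hL : 1 ∉ levels X (longRoots K n)) (hL2 : 2 ∉ levels X (longRoots K n)) :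
    levels X (longRoots K n) ⊆ {k | 4 ∣ k} := by
  intro l hl
  have heven : l % 2 = 0 := Int.even_iff.1 (hX.levels_long_subset_even h1 hL hl)
  by_contra hdvd
  apply hL2
  convert hX.long_add_short_mem_levels h1 hl (-(l / 4)) using 1
  have : l % 4 ≠ 0 := mt Int.dvd_of_emod_eq_zero hdvd
  omega

theorem eq_layered [NeZero n] (hint : ∀ u ∈ shortRoots K n, ∀ c, (u, c) ∈ X → ∃ k : ℤ, c = k)
    (h1 : 1 ∈ levels X (shortRoots K n)) (hlong : (levels X (longRoots K n)).Nonempty)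
    (hzero : ∀ k, Even k → k ∈ levels X (longRoots K n) → 0 ∈ levels X (longRoots K n)) :
    X = layered K n .univ .univ ∨ X = layered K n {k | Even k} {k | Even k} ∨
      X = layered K n .univ {k | Odd k} ∨
      (mediumRoots K n).Nonempty ∧ X = layered K n .univ {k | Even k} ∨
      X = layered K n {k | Even k} {k | 4 ∣ k} := by
  have hle {M L : Set ℤ} := hX.subset_layered (M := M) (L := L) hint
  by_cases hL : 1 ∈ levels X (longRoots K n)
  · by_cases h0 : 0 ∈ levels X (longRoots K n)
    · exact .inl ((hle (Set.subset_univ _) (Set.subset_univ _)).antisymm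
        (hX.layered_univ_univ_subset h0 hL))
    · refine .inr (.inr (.inl ((hle (Set.subset_univ _) fun k hk => ?_).antisymm
        (hX.layered_univ_odd_subset hL))))
      exact Int.not_even_iff_odd.1 fun heven => h0 (hzero k heven hk)
  · have heven := hX.levels_long_subset_even h1 hL
    have h0 : 0 ∈ levels X (longRoots K n) := hlong.elim fun k hk => hzero k (heven hk) hk
    by_cases hM : 1 ∈ levels X (mediumRoots K n)
    · exact .inr (.inr (.inr (.inl ⟨hM.imp fun _ => And.left,
        (hle (Set.subset_univ _) heven).antisymm (hX.layered_univ_even_subset h0 hM)⟩)))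
    · have heven' := hX.levels_medium_subset_even h1 hM
      by_cases h2 : 2 ∈ levels X (longRoots K n)
      · exact .inr (.inl ((hle heven' heven).antisymm (hX.layered_even_even_subset h0 h2 h1)))
      · exact .inr (.inr (.inr (.inr ((hle heven'
          (hX.levels_long_subset_four_dvd h1 hL h2)).antisymm
          (hX.layered_even_four_dvd_subset h0 h1)))))

end IsPointedSystem

end Classification

section RealRoots

variable {K : Type*} [Field K] {m : ℕ}

theorem deltaVec_eq_single {n : ℕ} (i : Fin n) : deltaVec K n i = Pi.single i 1 := by
  ext k
  simp [deltaVec, Pi.single_apply, Fin.ext_iff]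

theorem deltaVec_zero : deltaVec K (m + 1) 0 = Pi.single 0 1 := deltaVec_eq_single 0

theorem neg_deltaVec_zero_mem_shortRoots : -deltaVec K (m + 1) 0 ∈ shortRoots K (m + 1) := by
  rw [deltaVec_zero]
  exact neg_mem_shortRoots (single_mem_shortRoots 0)

theorem neg_two_smul_deltaVec_zero_mem_longRoots :
    -((2 : K) • deltaVec K (m + 1) 0) ∈ longRoots K (m + 1) := by
  rw [← smul_neg]
  exact two_smul_mem_longRoots neg_deltaVec_zero_mem_shortRoots

variable {a₀ : (Fin (m + 1) → K) × K}

theorem affineSimpleRoots_castSucc_succ (i : Fin m) :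
    affineSimpleRoots K (m + 1) a₀ i.castSucc.succ =
      (Pi.single i.castSucc 1 - Pi.single i.succ 1, 0) := by
  rw [affineSimpleRoots, Fin.cons_succ, deltaVec_eq_single, Fin.val_castSucc, ← Fin.val_succ,
    deltaVec_eq_single]

theorem affineSimpleRoots_last :
    affineSimpleRoots K (m + 1) a₀ (Fin.last (m + 1)) = (Pi.single (Fin.last m) 1, 0) := by
  have h : deltaVec K (m + 1) (m + 1) = 0 := by
    ext k
    simpa [deltaVec] using k.2.ne
  rw [← Fin.succ_last, affineSimpleRoots, Fin.cons_succ, deltaVec_eq_single, Fin.val_last, h,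
    sub_zero]

variable {odd : Set (Fin (m + 2))} {M L : Set ℤ}

theorem fst_mem_rootsB0_of_mem_layered {n : ℕ} {p : (Fin n → K) × K} (hp : p ∈ layered K n M L) :
    p.1 ∈ rootsB0 K n := by
  obtain ⟨k, -, h | ⟨h, -⟩ | ⟨h, -⟩⟩ := hp <;> simp [mem_rootsB0_iff, h]

theorem single_sub_single_mem_mediumRoots {n : ℕ} {i j : Fin n} (hij : i ≠ j) :
    Pi.single i 1 - Pi.single j 1 ∈ mediumRoots K n :=
  ⟨_, single_mem_shortRoots i, _, neg_mem_shortRoots (single_mem_shortRoots j),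
    by simp [deltaForm_single_single, hij], sub_eq_add_neg _ _⟩

theorem two_smul_affineSimpleRoots_last_mem_layered (hL0 : 0 ∈ L) :
    (2 : K) • affineSimpleRoots K (m + 1) a₀ (Fin.last (m + 1)) ∈ layered K (m + 1) M L := by
  rw [affineSimpleRoots_last]
  exact ⟨0, by simp, .inr (.inr ⟨⟨_, single_mem_shortRoots _, rfl⟩, hL0⟩)⟩

theorem one_mem_levels_realRoots {y : Fin (m + 1) → K} {T : Set (Fin (m + 1) → K)} (hy : y ∈ T) :
    1 ∈ levels {v | IsRealRoot (affineForm K (m + 1)) (affineSimpleRoots K (m + 1) (y, 1)) odd v}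
      T := by
  refine mem_levels hy ?_
  rw [Int.cast_one]
  exact .simple 0

theorem zero_mem_levels_realRoots (hodd : Fin.last (m + 1) ∈ odd) :
    0 ∈ levels {v | IsRealRoot (affineForm K (m + 1)) (affineSimpleRoots K (m + 1) a₀) odd v}
      (longRoots K (m + 1)) := by
  refine mem_levels (two_smul_mem_longRoots (single_mem_shortRoots (Fin.last m))) ?_
  have h : IsRealRoot (affineForm K (m + 1)) _ odd _ :=
    .double (a := affineSimpleRoots K (m + 1) a₀) _ hodd
  rw [affineSimpleRoots_last] at h
  simpa using h

theorem affineSimpleRoots_eq_or_mem_layered (hM0 : 0 ∈ M) (i : Fin (m + 2)) :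
    affineSimpleRoots K (m + 1) a₀ i = a₀ ∨ ∃ x ∈ rootsB0 K (m + 1),
      affineSimpleRoots K (m + 1) a₀ i = (x, 0) ∧ (x, 0) ∈ layered K (m + 1) M L := by
  induction i using Fin.cases with
  | zero => exact .inl rfl
  | succ i =>
    right
    induction i using Fin.lastCases with
    | last =>
      have hshort := single_mem_shortRoots (K := K) (Fin.last m)
      rw [Fin.succ_last, affineSimpleRoots_last]
      exact ⟨_, mem_rootsB0_iff.2 (.inl hshort), rfl, 0, Int.cast_zero.symm, .inl hshort⟩
    | cast i =>
      have hmedium := single_sub_single_mem_mediumRoots (K := K) i.castSucc_lt_succ.ne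
      rw [affineSimpleRoots_castSucc_succ]
      exact ⟨_, mem_rootsB0_iff.2 (.inr (.inl hmedium)), rfl, 0, Int.cast_zero.symm,
        .inr (.inl ⟨hmedium, hM0⟩)⟩

variable [CharZero K]

theorem realRoots_subset_layered {y : Fin (m + 1) → K} {w : ℤ}
    (hw : ∀ x ∈ deltaLattice K (m + 1), ∃ k : ℤ, coroot (deltaForm K (m + 1)) y x = (w * k : ℤ))
    (hM0 : 0 ∈ M) (hM : ∀ l ∈ M, ∀ k, l + w * k ∈ M) (hL : ∀ l ∈ L, ∀ k, l + 2 * w * k ∈ L)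
    (hy : (y, 1) ∈ layered K (m + 1) M L)
    (hodd : ∀ i ∈ odd, (2 : K) • affineSimpleRoots K (m + 1) (y, 1) i ∈ layered K (m + 1) M L) :
    {v | IsRealRoot (affineForm K (m + 1)) (affineSimpleRoots K (m + 1) (y, 1)) odd v} ⊆
      layered K (m + 1) M L := by
  have hcases := affineSimpleRoots_eq_or_mem_layered (a₀ := (y, (1 : K))) (L := L) hM0
  intro v hv
  induction hv with
  | simple i =>
    obtain h | ⟨x, -, h, hx⟩ := hcases i
    · rwa [h]
    · rwa [h]
  | double i hi => exact hodd i hi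
  | reflect i v _ ih =>
    obtain h | ⟨x, hx, h, -⟩ := hcases i
    · rw [h]
      have h1 := rootReflection_mem_layered (d := 1) (fst_mem_rootsB0_of_mem_layered hy) hw
        (by simpa using hM) (by simpa using hL) ih
      rwa [Int.cast_one] at h1
    · rw [h]
      exact rootReflection_mem_layered_of_mem_rootsB0 hx ih

theorem isPointedSystem_realRoots
    (h : {v | IsRealRoot (affineForm K (m + 1)) (affineSimpleRoots K (m + 1) a₀) odd v} ⊆
      layered K (m + 1) M L) :
    IsPointedSystem
      {v | IsRealRoot (affineForm K (m + 1)) (affineSimpleRoots K (m + 1) a₀) odd v} := by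
  refine isPointedSystem_of_simple (fun p hp => fst_mem_rootsB0_of_mem_layered (h hp))
    (fun p hp q hq => hp.rootReflection isSymm_affineForm hq) (fun i => ?_) ?_
  · rw [← affineSimpleRoots_castSucc_succ]
    exact .simple _
  · rw [← affineSimpleRoots_last]
    exact .simple _

theorem realRootsB0_eq_layered : realRootsB0 K (m + 1) = layered K (m + 1) .univ .univ := by
  have hlong : -((2 : K) • deltaVec K (m + 1) 0) ∈ longRoots K (m + 1) :=
    neg_two_smul_deltaVec_zero_mem_longRoots
  have hsub : realRootsB0 K (m + 1) ⊆ layered K (m + 1) .univ .univ := by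
    refine realRoots_subset_layered (w := 1) ?_ trivial (by simp) (by simp)
      ⟨1, by simp, by simp [hlong]⟩ ?_
    · simpa using fun x => exists_coroot_eq_intCast (mem_rootsB0_iff.2 (.inr (.inr hlong)))
    · rintro _ rfl
      exact two_smul_affineSimpleRoots_last_mem_layered trivial
  exact hsub.antisymm ((isPointedSystem_realRoots hsub).layered_univ_univ_subset
    (zero_mem_levels_realRoots rfl) (one_mem_levels_realRoots hlong))

theorem realRootsA2_eq_layered :
    realRootsA2 K (m + 1) = layered K (m + 1) .univ {k | Odd k} := by
  have hlong : -((2 : K) • deltaVec K (m + 1) 0) ∈ longRoots K (m + 1) :=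
    neg_two_smul_deltaVec_zero_mem_longRoots
  have hsub : realRootsA2 K (m + 1) ⊆ layered K (m + 1) .univ {k | Odd k} := by
    refine realRoots_subset_layered (w := 1) ?_ trivial (by simp) (fun l hl k => ?_)
      ⟨1, by simp, by simp [hlong]⟩ (by simp)
    · simpa using fun x => exists_coroot_eq_intCast (mem_rootsB0_iff.2 (.inr (.inr hlong)))
    · rw [mul_one]
      exact hl.add_even (even_two_mul k)
  exact hsub.antisymm ((isPointedSystem_realRoots hsub).layered_univ_odd_subset
    (one_mem_levels_realRoots hlong))

theorem realRootsA0odd2_eq_layered :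
    realRootsA0odd2 K (m + 2) = layered K (m + 2) .univ {k | Even k} := by
  have hmedium : -deltaVec K (m + 2) 0 - deltaVec K (m + 2) 1 ∈ mediumRoots K (m + 2) := by
    rw [sub_eq_add_neg, deltaVec_zero, show deltaVec K (m + 2) 1 = Pi.single 1 1 from
      deltaVec_eq_single 1]
    exact add_mem_mediumRoots (neg_mem_shortRoots (single_mem_shortRoots 0))
      (neg_mem_shortRoots (single_mem_shortRoots 1)) (by simp [deltaForm_single_single])
  have hsub : realRootsA0odd2 K (m + 2) ⊆ layered K (m + 2) .univ {k | Even k} := by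
    refine realRoots_subset_layered (w := 1) ?_ trivial (by simp) (fun l hl k => ?_)
      ⟨1, by simp, by simp [hmedium]⟩ ?_
    · simpa using fun x => exists_coroot_eq_intCast (mem_rootsB0_iff.2 (.inr (.inl hmedium)))
    · rw [mul_one]
      exact hl.add (even_two_mul k)
    · rintro _ rfl
      exact two_smul_affineSimpleRoots_last_mem_layered Even.zero
  exact hsub.antisymm ((isPointedSystem_realRoots hsub).layered_univ_even_subset
    (zero_mem_levels_realRoots rfl) (one_mem_levels_realRoots hmedium))

theorem realRootsA0even4_eq_layered :
    realRootsA0even4 K (m + 1) = layered K (m + 1) {k | Even k} {k | 4 ∣ k} := by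
  have hshort : -deltaVec K (m + 1) 0 ∈ shortRoots K (m + 1) := neg_deltaVec_zero_mem_shortRoots
  have hsub : realRootsA0even4 K (m + 1) ⊆ layered K (m + 1) {k | Even k} {k | 4 ∣ k} := by
    refine realRoots_subset_layered
      (fun x => exists_coroot_eq_two_mul_of_mem_shortRoots hshort) Even.zero
      (fun l hl k => hl.add (even_two_mul k)) (fun l hl k => ?_) ⟨1, by simp, .inl hshort⟩ ?_
    · exact dvd_add hl (dvd_mul_right _ _)
    · rintro _ rfl
      exact two_smul_affineSimpleRoots_last_mem_layered (dvd_zero 4)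
  exact hsub.antisymm ((isPointedSystem_realRoots hsub).layered_even_four_dvd_subset
    (zero_mem_levels_realRoots rfl) (one_mem_levels_realRoots hshort))

theorem realRootsC2_eq_layered :
    realRootsC2 K (m + 1) = layered K (m + 1) {k | Even k} {k | Even k} := by
  have hshort : -deltaVec K (m + 1) 0 ∈ shortRoots K (m + 1) := neg_deltaVec_zero_mem_shortRoots
  have hlong := two_smul_mem_longRoots hshort
  have hsub : realRootsC2 K (m + 1) ⊆ layered K (m + 1) {k | Even k} {k | Even k} := by
    refine realRoots_subset_layered
      (fun x => exists_coroot_eq_two_mul_of_mem_shortRoots hshort) Even.zero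
      (fun l hl k => hl.add (even_two_mul k)) (fun l hl k => ?_) ⟨1, by simp, .inl hshort⟩ ?_
    · exact hl.add ((even_two_mul 2).mul_right k)
    · rintro _ (rfl | rfl)
      · exact ⟨2, by simp [affineSimpleRoots], .inr (.inr ⟨hlong, even_two⟩)⟩
      · exact two_smul_affineSimpleRoots_last_mem_layered Even.zero
  have h2 : 2 ∈ levels (realRootsC2 K (m + 1)) (longRoots K (m + 1)) := by
    refine mem_levels hlong ?_
    have h : (2 : K) • (-deltaVec K (m + 1) 0, (1 : K)) ∈ realRootsC2 K (m + 1) :=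
      .double 0 (.inl rfl)
    simpa using h
  exact hsub.antisymm ((isPointedSystem_realRoots hsub).layered_even_even_subset
    (zero_mem_levels_realRoots (.inr rfl)) h2 (one_mem_levels_realRoots hshort))

end RealRoots

section RootStrings

theorem mem_iff_add_two_mul_mem_of_mem_closure {S : Set ℤ}
    (hS : ∀ x ∈ S, ∀ y ∈ S, y - 2 * x ∈ S) {h : ℤ} (hh : h ∈ AddSubgroup.closure S) (y : ℤ) :
    y ∈ S ↔ y + 2 * h ∈ S := by
  induction hh using AddSubgroup.closure_induction generalizing y with
  | mem x hx =>
    constructor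
    · intro hy
      have hneg : x - 2 * x ∈ S := hS x hx x hx
      convert hS _ hneg y hy using 1
      ring
    · intro hy
      simpa using hS x hx _ hy
  | zero => simp
  | add h h' _ _ ih ih' => rw [ih y, ih', mul_add, add_assoc]
  | neg h _ ih => rw [ih (y + 2 * -h), mul_neg, neg_add_cancel_right]

theorem exists_forall_mem_iff_dvd {S : Set ℤ} (h0 : 0 ∈ S)
    (hS : ∀ x ∈ S, ∀ y ∈ S, y - 2 * x ∈ S) : ∃ g : ℤ, ∀ k, k ∈ S ↔ g ∣ k := by
  obtain ⟨g, hg⟩ := Int.subgroup_cyclic (AddSubgroup.closure S)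
  have hmem (k : ℤ) : k ∈ AddSubgroup.closure S ↔ g ∣ k := by
    rw [hg, ← AddSubgroup.zmultiples_eq_closure, Int.mem_zmultiples_iff]
  have hdvd {k : ℤ} (hk : k ∈ S) : g ∣ k := (hmem k).1 (AddSubgroup.subset_closure hk)
  -- If all of `S` were even multiples of `g`, so would be its generator `g`, forcing `g = 0`.
  obtain ⟨o, ho⟩ : ∃ o, g * (2 * o + 1) ∈ S := by
    by_contra! hodd
    have heven : AddSubgroup.closure S ≤ AddSubgroup.zmultiples (2 * g) := by
      rw [AddSubgroup.closure_le]
      intro k hk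
      obtain ⟨m, rfl⟩ := hdvd hk
      obtain ⟨j, rfl | rfl⟩ := m.even_or_odd'
      · exact Int.mem_zmultiples_iff.2 ⟨j, by ring⟩
      · exact absurd hk (hodd j)
    obtain ⟨j, hj⟩ := Int.mem_zmultiples_iff.1 (heven ((hmem g).2 dvd_rfl))
    have hg0 : g * (2 * j - 1) = 0 := by linarith
    obtain rfl := (mul_eq_zero.1 hg0).resolve_right (by omega)
    exact hodd 0 (by rwa [zero_mul])
  refine ⟨g, fun k => ⟨hdvd, ?_⟩⟩
  have hadd (h : ℤ) (hh : g ∣ h) (y : ℤ) : y ∈ S ↔ y + 2 * h ∈ S :=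
    mem_iff_add_two_mul_mem_of_mem_closure hS ((hmem h).2 hh) y
  rintro ⟨m, rfl⟩
  obtain ⟨j, rfl | rfl⟩ := m.even_or_odd'
  · convert (hadd (g * j) (dvd_mul_right g _) 0).1 h0 using 1
    ring
  · convert (hadd (g * (j - o)) (dvd_mul_right g _) _).1 ho using 1
    ring

variable {K V : Type*} [Field K] [AddCommGroup V] [Module K V] {B : LinearMap.BilinForm K V}
  {R : Set V}

theorem rootReflection_add_of_mem_ker (hB : B.IsSymm) {v : V} (hv : v ∈ LinearMap.ker B) (α w : V) :
    rootReflection B (α + v) w = w - coroot B α w • (α + v) := by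
  have hv0 (w : V) : B v w = 0 := by rw [LinearMap.mem_ker.1 hv, LinearMap.zero_apply]
  rw [rootReflection_apply, coroot_apply, coroot_apply]
  simp only [map_add, LinearMap.add_apply, hv0, hB.eq α v, add_zero]

theorem IsAGRS.exists_forall_add_mem_iff (hR : IsAGRS B R) {α : V} (hα : α ∈ R)
    (hαα : B α α ≠ 0) :
    ∃ d ∈ LinearMap.ker B, ∀ v ∈ LinearMap.ker B, α + v ∈ R ↔ ∃ k : ℤ, v = k • d := by
  obtain ⟨d, hd, hdiscrete⟩ := hR.discrete _ ⟨α, hα, rfl⟩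
  have hclosed {v w : V} (hv : v ∈ LinearMap.ker B) (hw : w ∈ LinearMap.ker B) (hvR : α + v ∈ R)
      (hwR : α + w ∈ R) : α + (w - (2 : ℤ) • v) ∈ R := by
    have hvα : B (α + v) (α + v) ≠ 0 := by
      have hv0 := LinearMap.mem_ker.1 hv
      simpa [hv0, hR.symm.eq α v] using hαα
    have hcoroot {x : V} (hx : x ∈ LinearMap.ker B) : coroot B α (α + x) = 2 := by
      rw [map_add, coroot_apply_self hαα, coroot_apply, hR.symm.eq, LinearMap.mem_ker.1 hx]
      simp
    have h := (hR.reflection _ hvR hvα _ hwR).2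
    rw [rootReflection_add_of_mem_ker hR.symm hv, hcoroot hw] at h
    have h' := (hR.reflection _ hα hαα _ h).2
    rw [rootReflection_apply, map_sub, map_smul, hcoroot hv, hcoroot hw] at h'
    convert h' using 1
    module
  obtain ⟨g, hg⟩ := exists_forall_mem_iff_dvd (S := {k | α + k • d ∈ R}) (by simpa using hα)
    fun x hx y hy => by
      have h := hclosed (zsmul_mem hd x) (zsmul_mem hd y) hx hy
      rwa [smul_smul, ← sub_smul] at h
  refine ⟨g • d, zsmul_mem hd g, fun v hv => ⟨fun h => ?_, ?_⟩⟩
  · obtain ⟨m, hm⟩ := hdiscrete α hα _ h rfl (by simpa using hv)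
    rw [add_sub_cancel_left] at hm
    obtain ⟨k, rfl⟩ := (hg m).1 (show α + m • d ∈ R from hm ▸ h)
    exact ⟨k, by rw [hm, smul_smul, mul_comm]⟩
  · rintro ⟨k, rfl⟩
    rw [smul_smul]
    exact (hg _).2 (dvd_mul_left g k)

end RootStrings

section Coordinates

variable {K V : Type*} [Field K] [AddCommGroup V] [Module K V]

theorem exists_linearEquiv_prod {n : ℕ} {π : V →ₗ[K] Fin n → K} {e : Fin n → V}
    (he : ∀ i, π (e i) = Pi.single i 1) {z : V} (hz : z ≠ 0)
    (hker : LinearMap.ker π = Submodule.span K {z}) :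
    ∃ φ : V ≃ₗ[K] (Fin n → K) × K, (∀ v, (φ v).1 = π v) ∧
      (∀ i, φ (e i) = (Pi.single i 1, 0)) ∧ φ z = (0, 1) := by
  have hπz : π z = 0 := LinearMap.mem_ker.1 (hker ▸ Submodule.mem_span_singleton_self z)
  let G : ((Fin n → K) × K) →ₗ[K] V :=
    (Fintype.linearCombination K e).coprod (LinearMap.toSpanSingleton K V z)
  have hG (x c) : G (x, c) = Fintype.linearCombination K e x + c • z := by
    simp [G]
  have hπG (p) : π (G p) = p.1 := by
    have h : π ∘ₗ Fintype.linearCombination K e = LinearMap.id := by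
      ext i : 2
      simp [he]
    rw [hG, map_add, map_smul, hπz, smul_zero, add_zero]
    exact LinearMap.congr_fun h p.1
  have hbij : Function.Bijective G := by
    constructor
    · rw [injective_iff_map_eq_zero]
      rintro ⟨x, c⟩ h
      have hx := hπG (x, c)
      rw [h, map_zero] at hx
      obtain rfl : x = 0 := hx.symm
      simpa [hG, hz] using h
    · intro v
      have hv : v - G (π v, 0) ∈ LinearMap.ker π := by
        rw [LinearMap.mem_ker, map_sub, hπG, sub_self]
      rw [hker] at hv
      obtain ⟨c, hc⟩ := Submodule.mem_span_singleton.1 hv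
      refine ⟨(π v, c), ?_⟩
      simp only [hG, zero_smul, add_zero] at hc ⊢
      rw [hc, add_sub_cancel]
  let φ := (LinearEquiv.ofBijective G hbij).symm
  have hφG (p) : φ (G p) = p := (LinearEquiv.ofBijective G hbij).symm_apply_apply p
  have hGφ (v) : G (φ v) = v := (LinearEquiv.ofBijective G hbij).apply_symm_apply v
  refine ⟨φ, fun v => by rw [← hπG, hGφ], fun i => ?_, ?_⟩
  · simpa [hG] using hφG (Pi.single i 1, 0)
  · simpa [hG] using hφG (0, 1)

end Coordinates

section Realizations

variable {K V : Type*} [Field K] [AddCommGroup V] [Module K V] {B : LinearMap.BilinForm K V}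
  {R : Set V}

/-- `π` realizes `cl(R)` as `B(0,n)`: it is the projection along the kernel of `B` followed by an
isomorphism of systems, encoded without reference to the quotient space. -/
structure IsRealization {n : ℕ} (B : LinearMap.BilinForm K V) (R : Set V)
    (π : V →ₗ[K] Fin n → K) : Prop where
  ker_eq : LinearMap.ker π = LinearMap.ker B
  image_eq : π '' R = rootsB0 K n
  exists_form_eq : ∃ a : K, a ≠ 0 ∧ ∀ v w, deltaForm K n (π v) (π w) = a * B v w

theorem exists_isRealization {n : ℕ} (hB : B.IsSymm)
    (hcl : SystemIso (quotForm B hB) ((LinearMap.ker B).mkQ '' R) (deltaForm K n) (rootsB0 K n)) :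
    ∃ π : V →ₗ[K] Fin n → K, IsRealization B R π := by
  obtain ⟨ψ, himage, a, ha, hform⟩ := hcl
  refine ⟨ψ ∘ₗ (LinearMap.ker B).mkQ, ?_, ?_, a, ha, fun v w => hform _ _⟩
  · rw [LinearEquiv.ker_comp, Submodule.ker_mkQ]
  · rw [← himage, Set.image_image]
    rfl

namespace IsRealization

variable {n : ℕ} {π : V →ₗ[K] Fin n → K} (hπ : IsRealization B R π)
include hπ

theorem apply_mem_rootsB0 {α : V} (hα : α ∈ R) : π α ∈ rootsB0 K n :=
  hπ.image_eq ▸ Set.mem_image_of_mem π hα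

theorem exists_apply_eq {x : Fin n → K} (hx : x ∈ rootsB0 K n) : ∃ α ∈ R, π α = x := by
  rwa [← hπ.image_eq] at hx

theorem apply_self_ne_zero [CharZero K] {α : V} (hα : α ∈ R) : B α α ≠ 0 := by
  obtain ⟨a, -, hform⟩ := hπ.exists_form_eq
  exact fun h => deltaForm_self_ne_zero (hπ.apply_mem_rootsB0 hα) (by rw [hform, h, mul_zero])

theorem systemIso {φ : V ≃ₗ[K] (Fin n → K) × K} (hφ : ∀ v, (φ v).1 = π v)
    {X : Set ((Fin n → K) × K)} (hX : φ '' R = X) : SystemIso B R (affineForm K n) X := by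
  obtain ⟨a, ha, hform⟩ := hπ.exists_form_eq
  exact ⟨φ, hX, a, ha, fun v w => by rw [← hform, ← hφ, ← hφ]; rfl⟩

end IsRealization

end Realizations

section LiftedSimpleRoots

variable {K V : Type*} [Field K] [AddCommGroup V] [Module K V]
  {B : LinearMap.BilinForm K V} {R : Set V} {m : ℕ} {π : V →ₗ[K] Fin (m + 1) → K}
  (hπ : IsRealization B R π)
include hπ

theorem IsRealization.exists_lift {α : V} (hα : π α = Pi.single (Fin.last m) 1) :
    ∃ e : Fin (m + 1) → V, e (Fin.last m) = α ∧ (∀ i, π (e i) = Pi.single i 1) ∧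
      ∀ i : Fin m, e i.castSucc - e i.succ ∈ R := by
  choose a ha hπa using fun i : Fin m => hπ.exists_apply_eq (mem_rootsB0_iff.2
    (.inr (.inl (single_sub_single_mem_mediumRoots i.castSucc_lt_succ.ne))))
  let e : Fin (m + 1) → V := Fin.reverseInduction α fun i v => a i + v
  have hlast : e (Fin.last m) = α := Fin.reverseInduction_last ..
  have hcast (i : Fin m) : e i.castSucc = a i + e i.succ := Fin.reverseInduction_castSucc ..
  refine ⟨e, hlast, fun i => ?_, fun i => ?_⟩
  · induction i using Fin.reverseInduction with
    | last => rw [hlast, hα]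
    | cast i ih => rw [hcast, map_add, hπa, ih, sub_add_cancel]
  · rw [hcast, add_sub_cancel_right]
    exact ha i

variable [CharZero K] (hR : IsAGRS B R) {α : V} (hαR : α ∈ R)
  (hα : π α = Pi.single (Fin.last m) 1)
include hR hαR hα

theorem IsRealization.exists_isPointedSystem {z : V} (hz : z ∈ LinearMap.ker B) (hz0 : z ≠ 0) :
    ∃ φ : V ≃ₗ[K] (Fin (m + 1) → K) × K, (∀ v, (φ v).1 = π v) ∧
      φ α = (Pi.single (Fin.last m) 1, 0) ∧ φ z = (0, 1) ∧ IsPointedSystem (φ '' R) := by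
  obtain ⟨e, rfl, he, hsub⟩ := hπ.exists_lift hα
  have hspan : LinearMap.ker B = Submodule.span K {z} :=
    eq_span_singleton_of_mem_of_finrank_eq_one hR.finrank_ker hz hz0
  obtain ⟨φ, hφ, hφe, hφz⟩ := exists_linearEquiv_prod he hz0 (hπ.ker_eq.trans hspan)
  refine ⟨φ, hφ, hφe _, hφz, isPointedSystem_of_simple ?_ ?_ (fun i => ?_) ?_⟩
  · rintro _ ⟨β, hβ, rfl⟩
    rw [hφ]
    exact hπ.apply_mem_rootsB0 hβ
  · rintro _ ⟨β, hβ, rfl⟩ _ ⟨γ, hγ, rfl⟩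
    obtain ⟨a, ha, hform⟩ := hπ.exists_form_eq
    rw [← LinearEquiv.coe_coe, ← map_rootReflection (B := B) φ.toLinearMap ha
      fun v w => by rw [← hform, ← hφ, ← hφ]; rfl]
    exact ⟨_, (hR.reflection β hβ (hπ.apply_self_ne_zero hβ) γ hγ).2, rfl⟩
  · exact ⟨_, hsub i, by rw [map_sub, hφe, hφe, Prod.mk_sub_mk, sub_zero]⟩
  · exact ⟨_, hαR, hφe _⟩

theorem IsRealization.exists_ne_zero_forall_add_mem_iff :
    ∃ d ∈ LinearMap.ker B, d ≠ 0 ∧ ∀ v ∈ LinearMap.ker B, α + v ∈ R ↔ ∃ k : ℤ, v = k • d := by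
  obtain ⟨d, hd, hstring⟩ := hR.exists_forall_add_mem_iff hαR (hπ.apply_self_ne_zero hαR)
  refine ⟨d, hd, ?_, hstring⟩
  rintro rfl
  have : Nontrivial (LinearMap.ker B) := Module.nontrivial_of_finrank_eq_succ hR.finrank_ker
  obtain ⟨⟨z, hz⟩, hz0⟩ := exists_ne (0 : LinearMap.ker B)
  obtain ⟨φ, -, hφα, hφz, hX⟩ := hπ.exists_isPointedSystem hR hαR hα hz (by simpa using hz0)
  have hsnd : LinearMap.snd K (Fin (m + 1) → K) K ∘ₗ φ.toLinearMap = 0 := by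
    refine LinearMap.ext_on hR.span_eq_top fun β hβ => ?_
    obtain ⟨u, hu, huX⟩ := hX.exists_short_mem (Set.mem_image_of_mem φ hβ)
    obtain ⟨γ, hγ, hφγ⟩ := hX.mem_of_mem_shortRoots hu (single_mem_shortRoots (Fin.last m)) huX
    obtain rfl : γ = α + (φ β).2 • z :=
      φ.injective (by rw [hφγ, map_add, map_smul, hφα, hφz]; simp)
    obtain ⟨k, hk⟩ := (hstring _ (Submodule.smul_mem _ _ hz)).1 hγ
    rw [smul_zero, smul_eq_zero] at hk
    exact hk.resolve_right fun h => hz0 (Subtype.ext h)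
  have hone := LinearMap.congr_fun hsnd z
  simp [hφz] at hone

theorem IsRealization.exists_isPointedSystem_forall_mem_iff :
    ∃ φ : V ≃ₗ[K] (Fin (m + 1) → K) × K, (∀ v, (φ v).1 = π v) ∧
      φ α = (Pi.single (Fin.last m) 1, 0) ∧ IsPointedSystem (φ '' R) ∧
      ∀ c, (Pi.single (Fin.last m) 1, c) ∈ φ '' R ↔ ∃ k : ℤ, c = k := by
  obtain ⟨d, hd, hd0, hstring⟩ := hπ.exists_ne_zero_forall_add_mem_iff hR hαR hα
  obtain ⟨φ, hφ, hφα, hφd, hX⟩ := hπ.exists_isPointedSystem hR hαR hα hd hd0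
  refine ⟨φ, hφ, hφα, hX, fun c => ?_⟩
  have hφc : φ (α + c • d) = (Pi.single (Fin.last m) 1, c) := by
    rw [map_add, map_smul, hφα, hφd]
    simp
  rw [← hφc, φ.injective.mem_set_image, hstring _ (Submodule.smul_mem _ c hd)]
  exact exists_congr fun k => by rw [← Int.cast_smul_eq_zsmul K, smul_left_inj hd0]

omit hαR hα

theorem IsRealization.exists_eq_layered :
    ∃ φ : V ≃ₗ[K] (Fin (m + 1) → K) × K, (∀ v, (φ v).1 = π v) ∧
      (φ '' R = layered K (m + 1) .univ .univ ∨
        φ '' R = layered K (m + 1) {k | Even k} {k | Even k} ∨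
        φ '' R = layered K (m + 1) .univ {k | Odd k} ∨
        (mediumRoots K (m + 1)).Nonempty ∧ φ '' R = layered K (m + 1) .univ {k | Even k} ∨
        φ '' R = layered K (m + 1) {k | Even k} {k | 4 ∣ k}) := by
  have hshort := single_mem_shortRoots (K := K) (Fin.last m)
  -- If some long root is the double of a short root, the origin `α` is chosen with `2α ∈ R`.
  obtain ⟨α, ⟨hαR, hα⟩, hdouble⟩ : ∃ α, (α ∈ R ∧ π α = Pi.single (Fin.last m) 1) ∧
      ∀ β ∈ R, π β = Pi.single (Fin.last m) 1 → (2 : K) • β ∈ R → (2 : K) • α ∈ R := by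
    by_cases h : ∃ β ∈ R, π β = Pi.single (Fin.last m) 1 ∧ (2 : K) • β ∈ R
    · obtain ⟨β, hβ, hπβ, h2⟩ := h
      exact ⟨β, ⟨hβ, hπβ⟩, fun _ _ _ _ => h2⟩
    · obtain ⟨α, hα⟩ := hπ.exists_apply_eq (mem_rootsB0_iff.2 (.inl hshort))
      exact ⟨α, hα, fun β hβ hπβ h2 => absurd ⟨β, hβ, hπβ, h2⟩ h⟩
  obtain ⟨φ, hφ, hφα, hX, hmem⟩ := hπ.exists_isPointedSystem_forall_mem_iff hR hαR hα
  have hint (u) (hu : u ∈ shortRoots K (m + 1)) (c) (h : (u, c) ∈ φ '' R) : ∃ k : ℤ, c = k :=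
    (hmem c).1 (hX.mem_of_mem_shortRoots hu hshort h)
  refine ⟨φ, hφ, hX.eq_layered hint (mem_levels hshort ((hmem _).2 ⟨1, rfl⟩)) ?_ ?_⟩
  · have hlong := two_smul_mem_longRoots hshort
    obtain ⟨γ, hγ, hπγ⟩ := hπ.exists_apply_eq (mem_rootsB0_iff.2 (.inr (.inr hlong)))
    obtain ⟨u, hu, huX⟩ := hX.exists_short_mem (Set.mem_image_of_mem φ hγ)
    obtain ⟨k, hk⟩ := hint u hu _ huX
    exact ⟨k, mem_levels hlong ⟨γ, hγ, Prod.ext (by rw [hφ, hπγ]) hk⟩⟩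
  · rintro _ ⟨j, rfl⟩ ⟨_, ⟨u, hu, rfl⟩, huX⟩
    obtain ⟨γ, hγ, hφγ⟩ := hX.two_smul_short_mem hu hshort huX
    obtain ⟨β, hβ, hφβ⟩ := (hmem j).2 ⟨j, rfl⟩
    obtain rfl : γ = (2 : K) • β := φ.injective (by rw [hφγ, map_smul, hφβ]; simp [two_mul])
    exact mem_levels (two_smul_mem_longRoots hshort)
      ⟨_, hdouble β hβ (by rw [← hφ, hφβ]) hγ, by rw [map_smul, hφα]; simp⟩

end LiftedSimpleRoots

theorem corollary6p2p3_general {K V : Type*} [Field K] [CharZero K]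
    [AddCommGroup V] [Module K V] (n : ℕ)
    (B : LinearMap.BilinForm K V) (R : Set V) (hR : IsAGRS B R)
    (hcl : SystemIso (quotForm B hR.symm) ((LinearMap.ker B).mkQ '' R)
      (deltaForm K n) (rootsB0 K n)) :
    SystemIso B R (affineForm K n) (realRootsB0 K n) ∨
    SystemIso B R (affineForm K n) (realRootsC2 K n) ∨
    SystemIso B R (affineForm K n) (realRootsA2 K n) ∨
    (2 ≤ n ∧ SystemIso B R (affineForm K n) (realRootsA0odd2 K n)) ∨
    SystemIso B R (affineForm K n) (realRootsA0even4 K n) := by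
  obtain ⟨π, hπ⟩ := exists_isRealization hR.symm hcl
  obtain ⟨α, hα⟩ := hR.nonempty
  obtain ⟨i, -⟩ := hπ.apply_mem_rootsB0 hα
  obtain ⟨m, rfl⟩ := Nat.exists_eq_add_one_of_ne_zero i.pos.ne'
  obtain ⟨φ, hφ, h | h | h | ⟨hmedium, h⟩ | h⟩ := hπ.exists_eq_layered hR
  · exact .inl (hπ.systemIso hφ (h.trans realRootsB0_eq_layered.symm))
  · exact .inr (.inl (hπ.systemIso hφ (h.trans realRootsC2_eq_layered.symm)))
  · exact .inr (.inr (.inl (hπ.systemIso hφ (h.trans realRootsA2_eq_layered.symm))))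
  · have hm := two_le_of_mediumRoots_nonempty hmedium
    obtain ⟨m, rfl⟩ := Nat.exists_eq_add_one_of_ne_zero (by omega : m ≠ 0)
    exact .inr (.inr (.inr (.inl
      ⟨hm, hπ.systemIso hφ (h.trans realRootsA0odd2_eq_layered.symm)⟩)))
  · exact .inr (.inr (.inr (.inr (hπ.systemIso hφ (h.trans realRootsA0even4_eq_layered.symm)))))

theorem corollary6p2p3 {K V : Type*} [Field K] [IsAlgClosed K] [CharZero K]
    [AddCommGroup V] [Module K V] (n : ℕ) (hn : 1 ≤ n)
    (B : LinearMap.BilinForm K V) (R : Set V) (hR : IsAGRS B R)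
    (hcl : SystemIso (quotForm B hR.symm) ((LinearMap.ker B).mkQ '' R)
      (deltaForm K n) (rootsB0 K n)) :
    SystemIso B R (affineForm K n) (realRootsB0 K n) ∨
    SystemIso B R (affineForm K n) (realRootsC2 K n) ∨
    SystemIso B R (affineForm K n) (realRootsA2 K n) ∨
    (2 ≤ n ∧ SystemIso B R (affineForm K n) (realRootsA0odd2 K n)) ∨
    SystemIso B R (affineForm K n) (realRootsA0even4 K n) :=
  corollary6p2p3_general n B R hR hcl
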